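/- **Setting.** Let $\alpha_t=e^{-t/2}$ and $\sigma_t=\sqrt{1-e^{-t}}$, so that the forward process $\mathrm dX_t=-\tfrac12X_t\,\mathrm dt+\mathrm dB_t$ on $\mathbb R^d$ satisfies $X_t\mid X_0=x_0\sim N(\alpha_tx_0,\sigma_t^2I_d)$. For a probability measure $P$ on $\mathbb R^d$, let $\nabla\log p_t$ be the score of $X_t$ when $X_0\sim P$. For a dataset $\mathcal D=(x_1,\dots,x_n)$, let $\nabla\log\hat p_t$ be the score of $X_t$ when $X_0\sim\frac1n\sum_i\delta_{x_i}$. Put $$\ell(x_0,s)=\mathbb E_{X_t\mid X_0=x_0}\Big[\Big\|-\frac{X_t-\alpha_tx_0}{\sigma_t^2}-s(X_t)\Big\|_2^2\Big],\qquad \text{Loss-Gap}_t=\frac1n\sum_{i=1}^n\big(\ell(x_i,\nabla\log p_t)-\ell(x_i,\nabla\log\hat p_t)\big).$$ **Hölder densities.** For $\beta=s+\gamma>0$ with $s=\lfloor\beta\rfloor$, $\gamma\in[0,1)$, and $f:\mathbb R^d\to\mathbb R$ of class $C^s$, let $$\|f\|_{\mathcal H^\beta}=\max_{|b|_1<s}\sup_x|\partial^bf(x)|+\max_{|b|_1=s}\sup_{x\ne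 y}\frac{|\partial^bf(x)-\partial^bf(y)|}{\|x-y\|_2^\gamma}$$ (the first term is $0$ if $s=0$). A density $p$ is *sub-Gaussian Hölder* with constants $(C,c_f,\beta,B)$ if it is the probability density proportional to $\exp(-C\|x\|_2^2/2)f(x)$ for some $f$ with $\|f\|_{\mathcal H^\beta}<B$ and $\inf f\ge c_f$. **Theorem.** Let $C,c_f,\beta,B,C_1,C_2,C_3,R,\delta_1,\delta_2,a_0,a_1,b>0$. There are $c>0$ and $d_0\in\mathbb N$, depending only on these constants, such that the following holds for all $d\ge d_0$, $K\ge1$, $n\ge1$. Let $P=\frac1K\sum_{k=1}^KP^{(k)}$, where $P^{(k)}$ is the law of $\mu^{(k)}+\Sigma^{1/2}\xi^{(k)}$ with a common positive semidefinite matrix $\Sigma\in\mathbb R^{d\times d}$, and suppose that for every $k$: * $\xi^{(k)}$ has independent entries with mean $0$ and variance $1$, and $\|\xi^{(k)}\|_{\psi_2}=\sup_{\|u\|_2=1}\|\langle\xi^{(k)},u\rangle\|_{\psi_2}\le C_1$, where $\|Y\|_{\psi_2}=\inf\{a>0:\mathbb E\,e^{Y^2/a^2}\le2\}$; * $\|\Sigma\|_F\le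 C_2\sqrt d$, $\|\Sigma\|_2\le C_3$ and $\|\mu^{(k)}\|_2\le R\sqrt d$; * $\Sigma^{1/2}\xi^{(k)}$ has a sub-Gaussian Hölder density with constants $(C,c_f,\beta,B)$. If $K\ge2$, suppose also that $\delta_1\sqrt d\le\Delta_{\min}\le\delta_2\sqrt d$, where $\Delta_{\min}=\min_{j\ne k}\|\mu^{(j)}-\mu^{(k)}\|_2$. Suppose $\log n\le b\,d$, and let $t_0>0$ and $t_1$ satisfy $\log\sigma_{t_0}\ge-a_0d$ and $\log\sigma_{t_1}\le-a_1\log d$. Then, for $x_1,\dots,x_n$ drawn i.i.d. from $P$ and for every $t\in[t_0,t_1]$, $$\mathbb E_{\mathcal D}\big[\text{Loss-Gap}_t\big]\ \ge\ c\,\big(d\,\sigma_t^{-2}+\operatorname{tr}\Sigma\big).$$ -/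

import Mathlib

open MeasureTheory ProbabilityTheory

noncomputable section

namespace DiffusionGap

/-- `ℝ^d` with the Euclidean norm. -/
abbrev Vec (d : ℕ) : Type := EuclideanSpace ℝ (Fin d)

/-! ### Forward process -/

/-- `α_t = e^{-t/2}`. -/
def alpha (t : ℝ) : ℝ := Real.exp (-t / 2)

/-- `σ_t = (1 - e^{-t})^{1/2}`. -/
def sigma (t : ℝ) : ℝ := Real.sqrt (1 - Real.exp (-t))

/-- Transition density `x₀ ↦ x` of the forward process `dX_t = -(1/2) X_t dt + dB_t` at time `t`:
the density at `x` of `N(α_t x₀, σ_t² I_d)`. -/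
def transitionDensity {d : ℕ} (t : ℝ) (x₀ x : Vec d) : ℝ :=
  (2 * Real.pi * sigma t ^ 2) ^ (-(d : ℝ) / 2) *
    Real.exp (-‖x - alpha t • x₀‖ ^ 2 / (2 * sigma t ^ 2))

/-- The law of `X_t` given `X_0 = x₀`. -/
def transitionLaw {d : ℕ} (t : ℝ) (x₀ : Vec d) : Measure (Vec d) :=
  volume.withDensity fun x => ENNReal.ofReal (transitionDensity t x₀ x)

/-- The density of `X_t` when `X_0` has law `P`. -/
def marginalDensity {d : ℕ} (t : ℝ) (P : Measure (Vec d)) (x : Vec d) : ℝ :=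
  ∫ x₀, transitionDensity t x₀ x ∂P

/-- The score `∇ log p_t` when `X_0` has law `P`. -/
def score {d : ℕ} (t : ℝ) (P : Measure (Vec d)) (x : Vec d) : Vec d :=
  gradient (fun y => Real.log (marginalDensity t P y)) x

/-- The denoising loss
`ℓ(x₀, s) = E[ ‖-(X_t - α_t x₀) / σ_t² - s(X_t)‖² | X_0 = x₀ ]` at time `t`. -/
def denoisingLoss {d : ℕ} (t : ℝ) (x₀ : Vec d) (s : Vec d → Vec d) : ℝ :=
  ∫ x, ‖-((sigma t ^ 2)⁻¹ • (x - alpha t • x₀)) - s x‖ ^ 2 ∂(transitionLaw t x₀)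

/-- The empirical law `n⁻¹ ∑ᵢ δ_{xᵢ}` of a dataset. -/
def empiricalLaw {d n : ℕ} (D : Fin n → Vec d) : Measure (Vec d) :=
  (n : ENNReal)⁻¹ • ∑ i, Measure.dirac (D i)

/-- The loss gap at time `t` between the true score and the empirical score. -/
def lossGap {d n : ℕ} (t : ℝ) (P : Measure (Vec d)) (D : Fin n → Vec d) : ℝ :=
  (1 / (n : ℝ)) * ∑ i, (denoisingLoss t (D i) (score t P) -
    denoisingLoss t (D i) (score t (empiricalLaw D)))

/-! ### Hölder norm and sub-Gaussian Hölder densities -/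

/-- The partial derivative of `f` along the coordinates `v 0, …, v (m - 1)`. The multi-indices of
order `m` are represented by the tuples `v : Fin m → Fin d`. -/
def partialDeriv {d m : ℕ} (v : Fin m → Fin d) (f : Vec d → ℝ) (x : Vec d) : ℝ :=
  iteratedFDeriv ℝ m f x fun i => EuclideanSpace.single (v i) (1 : ℝ)

/-- The Hölder norm of index `β = s + γ`, `s = ⌊β⌋`, `γ ∈ [0, 1)`, of a function of class `C^s`:
`max_{|b| < s} sup_x |∂^b f(x)| + max_{|b| = s} sup_{x ≠ y} |∂^b f(x) - ∂^b f(y)| / ‖x - y‖^γ`. -/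
def holderNorm {d : ℕ} (β : ℝ) (f : Vec d → ℝ) : ENNReal :=
  (⨆ (m : ℕ) (_ : m < ⌊β⌋₊) (v : Fin m → Fin d) (x : Vec d), ‖partialDeriv v f x‖ₑ) +
  ⨆ (v : Fin ⌊β⌋₊ → Fin d) (x : Vec d) (y : Vec d) (_ : x ≠ y),
    ‖partialDeriv v f x - partialDeriv v f y‖ₑ / edist x y ^ (β - (⌊β⌋₊ : ℝ))

/-- The Hölder ball of index `β` and radius `B`. -/
def holderBall (d : ℕ) (β B : ℝ) : Set (Vec d → ℝ) :=
  {f | ContDiff ℝ (⌊β⌋₊ : ℕ) f ∧ holderNorm β f < ENNReal.ofReal B}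

/-- `p` is a sub-Gaussian Hölder density: `p` is the probability density proportional to
`exp(-C ‖x‖² / 2) f(x)`, with `f` in the Hölder ball of radius `B` and `f ≥ c_f`. -/
def IsSubGaussianHolderDensity {d : ℕ} (C cf β B : ℝ) (p : Vec d → ℝ) : Prop :=
  ∃ f ∈ holderBall d β B, (∀ x, cf ≤ f x) ∧
    ∀ x, p x = Real.exp (-C * ‖x‖ ^ 2 / 2) * f x /
      ∫ y : Vec d, Real.exp (-C * ‖y‖ ^ 2 / 2) * f y

/-! ### Sub-Gaussian norm -/

/-- `‖Y‖_{ψ₂} = inf {a > 0 : E exp(Y² / a²) ≤ 2}` for a real random variable `Y`. -/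
def psi2Norm {Ω : Type*} [MeasurableSpace Ω] (P : Measure Ω) (Y : Ω → ℝ) : ENNReal :=
  ⨅ (a : ℝ) (_ : 0 < a)
    (_ : ∫⁻ ω, ENNReal.ofReal (Real.exp (Y ω ^ 2 / a ^ 2)) ∂P ≤ 2), ENNReal.ofReal a

/-- The sub-Gaussian norm `sup_{‖u‖ = 1} ‖⟨ξ, u⟩‖_{ψ₂}` of a random vector `ξ` with law `ν`. -/
def psi2NormVec {d : ℕ} (ν : Measure (Vec d)) : ENNReal :=
  ⨆ (u : Vec d) (_ : ‖u‖ = 1), psi2Norm ν fun x => inner ℝ x u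

/-! ### Mixture model -/

/-- `A ↦ A x` for a square matrix acting on `ℝ^d`. -/
def act {d : ℕ} (A : Matrix (Fin d) (Fin d) ℝ) : Vec d →L[ℝ] Vec d :=
  Matrix.toEuclideanCLM (n := Fin d) (𝕜 := ℝ) A

/-- The Frobenius norm. -/
def frobenius {d : ℕ} (A : Matrix (Fin d) (Fin d) ℝ) : ℝ :=
  Real.sqrt (∑ i, ∑ j, A i j ^ 2)

section
open scoped MatrixOrder

/-- The law of `Σ^{1/2} ξ` for `ξ` of law `ν`. -/
def noiseLaw {d : ℕ} (S : Matrix (Fin d) (Fin d) ℝ) (ν : Measure (Vec d)) : Measure (Vec d) :=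
  ν.map fun z => act (CFC.sqrt S) z

end

/-- The law of `μ + Σ^{1/2} ξ` for `ξ` of law `ν`. -/
def componentLaw {d : ℕ} (μ : Vec d) (S : Matrix (Fin d) (Fin d) ℝ) (ν : Measure (Vec d)) :
    Measure (Vec d) :=
  (noiseLaw S ν).map fun z => μ + z

/-- The equal-weight mixture of the component laws. -/
def mixtureLaw {d K : ℕ} (μ : Fin K → Vec d) (S : Matrix (Fin d) (Fin d) ℝ)
    (ν : Fin K → Measure (Vec d)) : Measure (Vec d) :=
  (K : ENNReal)⁻¹ • ∑ k, componentLaw (μ k) S (ν k)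

/-- `Δ_min`, the least distance between the means of two different components. -/
def minSeparation {d K : ℕ} (μ : Fin K → Vec d) : ℝ :=
  sInf {r | ∃ j k : Fin K, j ≠ k ∧ r = ‖μ j - μ k‖}

/-- The assumption on a component `μ + Σ^{1/2} ξ`, with `ξ` of law `ν` and with constants
`C, cf, β, B` for the density, `C₁` for `‖ξ‖_{ψ₂}`, `C₂` and `C₃` for the Frobenius and the
spectral norm of `Σ`, and `R` for the mean. -/
structure ComponentAssumption {d : ℕ} (C cf β B C₁ C₂ C₃ R : ℝ) (μ : Vec d)
    (S : Matrix (Fin d) (Fin d) ℝ) (ν : Measure (Vec d)) : Prop where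
  isProbabilityMeasure : IsProbabilityMeasure ν
  indep : iIndepFun (fun (i : Fin d) (x : Vec d) => x i) ν
  mean_zero : ∀ i, ∫ x, x i ∂ν = 0
  unit_variance : ∀ i, variance (fun x : Vec d => x i) ν = 1
  psi2_le : psi2NormVec ν ≤ ENNReal.ofReal C₁
  posSemidef : S.PosSemidef
  frobenius_le : frobenius S ≤ C₂ * Real.sqrt d
  opNorm_le : ‖act S‖ ≤ C₃
  density : ∃ p : Vec d → ℝ, IsSubGaussianHolderDensity C cf β B p ∧
    noiseLaw S ν = volume.withDensity fun x => ENNReal.ofReal (p x)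
  mean_le : ‖μ‖ ≤ R * Real.sqrt d

end DiffusionGap

end

namespace DiffusionGap

/-! The true score cannot tell which `x₀` produced `X_t = x`, while the empirical score almost
always can.

Population side: each component has a density `exp(-C‖x - μ‖²/2) g(x)` up to a constant, where `g`
varies by at most a Gaussian factor (`exists_gaussianDoubling`). Multiplying by the transition
density and completing the square gives a posterior of the same shape with precision `θ = C +
α²/σ²`. Such a density puts little mass on any ball of radius `ε √(d/θ)`, so every guess of `x₀` has
squared error of order `d/θ`. In the score scale this is of order `d/σ²`
(`IsGaussianTilt.le_lintegral_condScore_sub`). The bound holds for each `x` and each guess and is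
linear in the prior, so it passes to mixtures.

Empirical side: by Tweedie's formula the empirical score is the best mean-square predictor for the
empirical law, so any explicit estimator bounds its loss. `exists_estimator` takes the unique data
point near `x/α`. It errs only when the noise is atypically large or two data points lie within
`8σ√d/α` of each other. The first event costs a factor `e^{-2d}`. The second has probability at most
`n A² r^{d/2}` by the small-ball bound for the prior, with `r` of order `σ²`; since `σ_t ≤ d^{-a₁}`,
this beats `n ≤ e^{bd}`.

Thus the gap is at least a multiple of `d/σ²`, which also dominates `tr Σ ≤ C₂ d`. -/

/-! ### Gaussian integrals and small balls. -/

theorem lintegral_exp_neg_mul_norm_sub_sq {d : ℕ} {b : ℝ} (hb : 0 < b) (m : Vec d) :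
    ∫⁻ x, ENNReal.ofReal (Real.exp (-b * ‖x - m‖ ^ 2)) =
      ENNReal.ofReal ((Real.pi / b) ^ ((d : ℝ) / 2)) := by
  have h1 := GaussianFourier.integral_rexp_neg_mul_sq_norm (V := Vec d) hb
  have hpos : 0 < (Real.pi / b) ^ ((d : ℝ) / 2) :=
    Real.rpow_pos_of_pos (div_pos Real.pi_pos hb) _
  simp only [finrank_euclideanSpace, Fintype.card_fin] at h1
  -- A Bochner integral with nonzero value certifies integrability.
  have hint : Integrable (fun v : Vec d => Real.exp (-b * ‖v‖ ^ 2)) := by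
    by_contra h
    rw [integral_undef h] at h1
    exact hpos.ne h1
  have h2 := lintegral_sub_right_eq_self (μ := (volume : Measure (Vec d)))
    (fun x => ENNReal.ofReal (Real.exp (-b * ‖x‖ ^ 2))) m
  rw [h2, ← ofReal_integral_eq_lintegral_ofReal hint
    (Filter.Eventually.of_forall fun _ => (Real.exp_pos _).le), h1]

/-- The indicator of the ball is at most `e^{d/2}` times a Gaussian of variance `q²`, so no
Gamma-function formula is needed. -/
theorem volume_closedBall_le {d : ℕ} {q : ℝ} (hq : 0 < q) (z : Vec d) :
    volume (Metric.closedBall z (q * Real.sqrt d)) ≤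
      ENNReal.ofReal ((2 * Real.pi * Real.exp 1 * q ^ 2) ^ ((d : ℝ) / 2)) := by
  have hl : 0 < 1 / (2 * q ^ 2) := by positivity
  have key : ∀ x ∈ Metric.closedBall z (q * Real.sqrt d), (1 : ENNReal) ≤
      ENNReal.ofReal (Real.exp (d / 2)) *
        ENNReal.ofReal (Real.exp (-(1 / (2 * q ^ 2)) * ‖x - z‖ ^ 2)) := by
    intro x hx
    rw [Metric.mem_closedBall, dist_eq_norm] at hx
    rw [← ENNReal.ofReal_mul (Real.exp_pos _).le, ← Real.exp_add, ENNReal.one_le_ofReal]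
    apply Real.one_le_exp
    have h : ‖x - z‖ ^ 2 ≤ q ^ 2 * d := by
      calc ‖x - z‖ ^ 2 ≤ (q * Real.sqrt d) ^ 2 := by gcongr
        _ = q ^ 2 * d := by rw [mul_pow, Real.sq_sqrt (Nat.cast_nonneg d)]
    have : 1 / (2 * q ^ 2) * ‖x - z‖ ^ 2 ≤ 1 / (2 * q ^ 2) * (q ^ 2 * d) := by gcongr
    have h3 : 1 / (2 * q ^ 2) * (q ^ 2 * d) = (d : ℝ) / 2 := by field_simp
    linarith
  calc volume (Metric.closedBall z (q * Real.sqrt d))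
      = ∫⁻ x in Metric.closedBall z (q * Real.sqrt d), 1 := by simp
    _ ≤ ∫⁻ x in Metric.closedBall z (q * Real.sqrt d), ENNReal.ofReal (Real.exp (d / 2)) *
        ENNReal.ofReal (Real.exp (-(1 / (2 * q ^ 2)) * ‖x - z‖ ^ 2)) :=
        setLIntegral_mono' Metric.isClosed_closedBall.measurableSet key
    _ ≤ ∫⁻ x, ENNReal.ofReal (Real.exp (d / 2)) *
        ENNReal.ofReal (Real.exp (-(1 / (2 * q ^ 2)) * ‖x - z‖ ^ 2)) :=
        setLIntegral_le_lintegral _ _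
    _ = ENNReal.ofReal (Real.exp (d / 2) * (Real.pi / (1 / (2 * q ^ 2))) ^ ((d : ℝ) / 2)) := by
        rw [lintegral_const_mul' _ _ ENNReal.ofReal_ne_top,
          lintegral_exp_neg_mul_norm_sub_sq hl, ENNReal.ofReal_mul (Real.exp_pos _).le]
    _ = _ := by
        congr 1
        have : Real.exp ((d : ℝ) / 2) = Real.exp 1 ^ ((d : ℝ) / 2) := by
          rw [← Real.exp_mul, one_mul]
        rw [this, ← Real.mul_rpow (Real.exp_pos _).le (by positivity)]
        congr 1
        field_simp

/-- Small-ball estimate for a density trapped between a constant and a Gaussian. -/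
theorem setLIntegral_closedBall_le {d : ℕ} {θ A L q : ℝ} (hθ : 0 < θ) (hA : 0 < A) (hL : 0 < L)
    (hq : 0 < q) {H : Vec d → ℝ} {m : Vec d} (hu : ∀ x, H x ≤ A * L)
    (hl : ∀ x, L / A * Real.exp (-θ * ‖x - m‖ ^ 2) ≤ H x) (z : Vec d) :
    ∫⁻ x in Metric.closedBall z (q * Real.sqrt d), ENNReal.ofReal (H x) ≤
      ENNReal.ofReal (A ^ 2 * (2 * Real.exp 1 * θ * q ^ 2) ^ ((d : ℝ) / 2)) *
        ∫⁻ x, ENNReal.ofReal (H x) := by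
  -- The Gaussian minorant bounds the total mass below; its volume factor `(π/θ)^{d/2}` is what the
  -- ball's volume is compared with.
  have low : ENNReal.ofReal (L / A * (Real.pi / θ) ^ ((d : ℝ) / 2)) ≤
      ∫⁻ x, ENNReal.ofReal (H x) := by
    rw [ENNReal.ofReal_mul (by positivity), ← lintegral_exp_neg_mul_norm_sub_sq hθ m,
      ← lintegral_const_mul' _ _ ENNReal.ofReal_ne_top]
    refine lintegral_mono fun x => ?_
    rw [← ENNReal.ofReal_mul (by positivity)]
    exact ENNReal.ofReal_le_ofReal (hl x)
  calc ∫⁻ x in Metric.closedBall z (q * Real.sqrt d), ENNReal.ofReal (H x)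
      ≤ ∫⁻ x in Metric.closedBall z (q * Real.sqrt d), ENNReal.ofReal (A * L) :=
        lintegral_mono fun x => ENNReal.ofReal_le_ofReal (hu x)
    _ = ENNReal.ofReal (A * L) * volume (Metric.closedBall z (q * Real.sqrt d)) := by simp
    _ ≤ ENNReal.ofReal (A * L) *
        ENNReal.ofReal ((2 * Real.pi * Real.exp 1 * q ^ 2) ^ ((d : ℝ) / 2)) := by
        gcongr; exact volume_closedBall_le hq z
    _ = ENNReal.ofReal (A ^ 2 * (2 * Real.exp 1 * θ * q ^ 2) ^ ((d : ℝ) / 2)) *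
        ENNReal.ofReal (L / A * (Real.pi / θ) ^ ((d : ℝ) / 2)) := by
        rw [← ENNReal.ofReal_mul (by positivity), ← ENNReal.ofReal_mul (by positivity)]
        congr 1
        have : 2 * Real.pi * Real.exp 1 * q ^ 2 =
            (2 * Real.exp 1 * θ * q ^ 2) * (Real.pi / θ) := by field_simp
        rw [this, Real.mul_rpow (by positivity) (by positivity)]
        field_simp
    _ ≤ _ := by gcongr

/-! ### Functions with Gaussian variation, and Hölder densities. -/

/-- `g` varies at most by a Gaussian factor. -/
def GaussianDoubling {d : ℕ} (A κ : ℝ) (g : Vec d → ℝ) : Prop :=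
  Measurable g ∧ (∀ x, 0 < g x) ∧ ∀ x z, g x ≤ A * Real.exp (κ * ‖x - z‖ ^ 2) * g z

/-- Relative to its value at `m`, `g` grows at most like `exp(C‖x - m‖²/2)`, which the factor with
`θ ≥ C` cancels, and decays at most like the inverse, which at worst doubles the exponent. Allowing
any `θ ≥ C` covers both the prior (`θ = C`) and the posterior with one constant `A`. -/
theorem GaussianDoubling.setLIntegral_closedBall_le {d : ℕ} {C θ A q : ℝ} (hC : 0 < C)
    (hθ : C ≤ θ) (hA : 0 < A) (hq : 0 < q) {g : Vec d → ℝ} (hg : GaussianDoubling A (C / 2) g)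
    (m z : Vec d) :
    ∫⁻ x in Metric.closedBall z (q * Real.sqrt d),
        ENNReal.ofReal (Real.exp (-θ * ‖x - m‖ ^ 2 / 2) * g x) ≤
      ENNReal.ofReal (A ^ 2 * (2 * Real.exp 1 * θ * q ^ 2) ^ ((d : ℝ) / 2)) *
        ∫⁻ x, ENNReal.ofReal (Real.exp (-θ * ‖x - m‖ ^ 2 / 2) * g x) := by
  refine DiffusionGap.setLIntegral_closedBall_le (lt_of_lt_of_le hC hθ) hA (hg.2.1 m) hq
    (m := m) (fun x => ?_) (fun x => ?_) z
  · calc Real.exp (-θ * ‖x - m‖ ^ 2 / 2) * g x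
        ≤ Real.exp (-θ * ‖x - m‖ ^ 2 / 2) * (A * Real.exp (C / 2 * ‖x - m‖ ^ 2) * g m) := by
          gcongr; exact hg.2.2 x m
      _ = Real.exp ((C - θ) / 2 * ‖x - m‖ ^ 2) * (A * g m) := by
          rw [show (C - θ) / 2 * ‖x - m‖ ^ 2 = -θ * ‖x - m‖ ^ 2 / 2 + C / 2 * ‖x - m‖ ^ 2 by ring,
            Real.exp_add]
          ring
      _ ≤ 1 * (A * g m) := by
          have := hg.2.1 m
          gcongr
          apply Real.exp_le_one_iff.2
          exact mul_nonpos_of_nonpos_of_nonneg (by linarith) (by positivity)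
      _ = A * g m := one_mul _
  · have h1 := hg.2.2 m x
    rw [norm_sub_rev] at h1
    have hgx := hg.2.1 x
    have h2 : g m / A * Real.exp (-(C / 2) * ‖x - m‖ ^ 2) ≤ g x := by
      rw [neg_mul, Real.exp_neg, ← div_eq_mul_inv, div_div, div_le_iff₀ (by positivity)]
      linarith
    calc g m / A * Real.exp (-θ * ‖x - m‖ ^ 2)
        ≤ g m / A * Real.exp (-θ * ‖x - m‖ ^ 2 / 2 + -(C / 2) * ‖x - m‖ ^ 2) := by
          have := hg.2.1 m
          gcongr
          nlinarith [sq_nonneg ‖x - m‖]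
      _ = Real.exp (-θ * ‖x - m‖ ^ 2 / 2) * (g m / A * Real.exp (-(C / 2) * ‖x - m‖ ^ 2)) := by
          rw [Real.exp_add]; ring
      _ ≤ _ := by gcongr

theorem GaussianDoubling.comp_sub {d : ℕ} {A κ : ℝ} {g : Vec d → ℝ} (hg : GaussianDoubling A κ g)
    (μ : Vec d) : GaussianDoubling A κ fun x => g (x - μ) :=
  ⟨hg.1.comp (measurable_id.sub_const μ), fun x => hg.2.1 _, fun x z => by
    simpa using hg.2.2 (x - μ) (z - μ)⟩

theorem exists_two_add_le_exp {κ : ℝ} (hκ : 0 < κ) :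
    ∃ A : ℝ, 1 ≤ A ∧ ∀ u : ℝ, 0 ≤ u → 2 + u ≤ A * Real.exp (κ * u ^ 2) := by
  refine ⟨3 + κ⁻¹, by linarith [inv_pos.2 hκ], fun u hu => ?_⟩
  have h1 : 1 + κ * u ^ 2 ≤ Real.exp (κ * u ^ 2) := by
    linarith [Real.add_one_le_exp (κ * u ^ 2)]
  have hk := inv_pos.2 hκ
  have h2 : κ⁻¹ * (κ * u ^ 2) = u ^ 2 := by field_simp
  calc 2 + u ≤ (3 + κ⁻¹) * (1 + κ * u ^ 2) := by
        nlinarith [sq_nonneg (u - 1), mul_nonneg hκ.le (sq_nonneg u)]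
    _ ≤ _ := by gcongr

/-- The bound depends on the Hölder class only, not on the dimension. -/
theorem exists_gaussianDoubling {cf β B κ : ℝ} (hcf : 0 < cf) (hβ : 0 < β) (hB : 0 < B)
    (hκ : 0 < κ) : ∃ A : ℝ, 0 < A ∧ ∀ (d : ℕ) (f : Vec d → ℝ), f ∈ holderBall d β B →
      (∀ x, cf ≤ f x) → GaussianDoubling A κ f := by
  obtain ⟨A₀, hA₀, hexp⟩ := exists_two_add_le_exp hκ
  refine ⟨A₀ * (1 + B / cf), by positivity, fun d f hf hlow => ⟨hf.1.continuous.measurable,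
    fun x => hcf.trans_le (hlow x), fun x z => ?_⟩⟩
  have hfz := hlow z
  -- The lower bound on `f` turns an additive error `B` into a multiplicative one.
  have hBc : B ≤ B / cf * f z := by
    rw [div_mul_eq_mul_div, le_div_iff₀ hcf]; gcongr
  suffices h : f x ≤ (2 + ‖x - z‖) * (1 + B / cf) * f z by
    refine h.trans ?_
    have := hexp ‖x - z‖ (norm_nonneg _)
    calc (2 + ‖x - z‖) * (1 + B / cf) * f z
        ≤ (A₀ * Real.exp (κ * ‖x - z‖ ^ 2)) * (1 + B / cf) * f z := by
          have : 0 < f z := hcf.trans_le hfz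
          gcongr
      _ = _ := by ring
  have hn := norm_nonneg (x - z)
  have hfz0 : 0 < f z := hcf.trans_le hfz
  have hBcf : 0 < B / cf := by positivity
  suffices h : f x ≤ f z + B * (1 + ‖x - z‖) by
    have : B * (1 + ‖x - z‖) ≤ (B / cf * f z) * (1 + ‖x - z‖) := by gcongr
    nlinarith [mul_pos hBcf hfz0, mul_nonneg hn hfz0.le]
  have hnorm := hf.2
  -- For `β < 1` the Hölder quotient bounds the increment; for `β ≥ 1` the order-zero term bounds
  -- `f` itself. Only derivatives of order zero enter, hence no dependence on `d`.
  rcases Nat.eq_zero_or_pos ⌊β⌋₊ with h0 | h0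
  · by_cases hxz : x = z
    · subst hxz; nlinarith
    have h1 : ‖f x - f z‖ₑ / edist x z ^ β ≤ ENNReal.ofReal B := by
      refine le_trans ?_ hnorm.le
      refine le_trans ?_ le_add_self
      rw [h0]
      refine le_iSup_of_le Fin.elim0 <| le_iSup_of_le x <| le_iSup_of_le z <|
        le_iSup_of_le hxz ?_
      simp [partialDeriv]
    have hpos : 0 < ‖x - z‖ := norm_pos_iff.2 (sub_ne_zero.2 hxz)
    have hed : edist x z ^ β = ENNReal.ofReal (‖x - z‖ ^ β) := by
      rw [edist_dist, dist_eq_norm, ENNReal.ofReal_rpow_of_pos hpos]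
    have hp : 0 < ‖x - z‖ ^ β := Real.rpow_pos_of_pos hpos _
    rw [hed, ENNReal.div_le_iff (by simpa using hp) ENNReal.ofReal_ne_top,
      ← ENNReal.ofReal_mul hB.le, Real.enorm_eq_ofReal_abs,
      ENNReal.ofReal_le_ofReal_iff (by positivity)] at h1
    have hβ1 : β ≤ 1 := (Nat.floor_eq_zero.1 h0).le
    have h2 : ‖x - z‖ ^ β ≤ 1 + ‖x - z‖ := by
      calc ‖x - z‖ ^ β ≤ (1 + ‖x - z‖) ^ β := by gcongr; linarith
        _ ≤ (1 + ‖x - z‖) ^ (1 : ℝ) := by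
          apply Real.rpow_le_rpow_of_exponent_le <;> linarith
        _ = _ := Real.rpow_one _
    have h3 : B * ‖x - z‖ ^ β ≤ B * (1 + ‖x - z‖) := by gcongr
    linarith [le_abs_self (f x - f z)]
  · have h1 : ‖f x‖ₑ ≤ ENNReal.ofReal B := by
      refine le_trans ?_ hnorm.le
      refine le_trans ?_ le_self_add
      refine le_iSup_of_le 0 <| le_iSup_of_le h0 <| le_iSup_of_le Fin.elim0 <|
        le_iSup_of_le x ?_
      simp [partialDeriv]
    rw [Real.enorm_eq_ofReal_abs, ENNReal.ofReal_le_ofReal_iff hB.le] at h1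
    nlinarith [le_abs_self (f x)]

/-! ### The transition kernel and the conditional score. -/

theorem sigma_pos {t : ℝ} (ht : 0 < t) : 0 < sigma t :=
  Real.sqrt_pos.2 (by simpa using ht)

theorem sigma_sq {t : ℝ} (ht : 0 < t) : sigma t ^ 2 = 1 - Real.exp (-t) :=
  Real.sq_sqrt (by simpa using ht.le)

theorem alpha_pos (t : ℝ) : 0 < alpha t := Real.exp_pos _

theorem alpha_sq {t : ℝ} (ht : 0 < t) : alpha t ^ 2 = 1 - sigma t ^ 2 := by
  rw [sigma_sq ht, alpha, ← Real.exp_nat_mul]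
  ring_nf

theorem sigma_le_one (t : ℝ) : sigma t ≤ 1 :=
  Real.sqrt_le_one.2 (by linarith [Real.exp_pos (-t)])

theorem sigma_mono {t t' : ℝ} (h : t ≤ t') : sigma t ≤ sigma t' :=
  Real.sqrt_le_sqrt (by gcongr)

theorem transitionDensity_pos {d : ℕ} {t : ℝ} (ht : 0 < t) (x₀ x : Vec d) :
    0 < transitionDensity t x₀ x :=
  mul_pos (Real.rpow_pos_of_pos (by have := sigma_pos ht; positivity) _) (Real.exp_pos _)

theorem continuous_transitionDensity {d : ℕ} (t : ℝ) :
    Continuous fun p : Vec d × Vec d => transitionDensity t p.1 p.2 := by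
  unfold transitionDensity
  fun_prop

theorem transitionDensity_le {d : ℕ} {t : ℝ} (x₀ x : Vec d) :
    transitionDensity t x₀ x ≤ (2 * Real.pi * sigma t ^ 2) ^ (-(d : ℝ) / 2) := by
  unfold transitionDensity
  refine mul_le_of_le_one_right (by positivity) (Real.exp_le_one_iff.2 ?_)
  rw [neg_div]
  exact neg_nonpos.2 (by positivity)

theorem lintegral_transitionDensity {d : ℕ} {t : ℝ} (ht : 0 < t) (x₀ : Vec d) :
    ∫⁻ x, ENNReal.ofReal (transitionDensity t x₀ x) = 1 := by
  have hs := sigma_pos ht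
  have h : ∀ x : Vec d, ENNReal.ofReal (transitionDensity t x₀ x) =
      ENNReal.ofReal ((2 * Real.pi * sigma t ^ 2) ^ (-(d : ℝ) / 2)) *
        ENNReal.ofReal (Real.exp (-(1 / (2 * sigma t ^ 2)) * ‖x - alpha t • x₀‖ ^ 2)) := by
    intro x
    rw [← ENNReal.ofReal_mul (by positivity), transitionDensity]
    congr 4
    ring
  simp_rw [h]
  rw [lintegral_const_mul' _ _ ENNReal.ofReal_ne_top,
    lintegral_exp_neg_mul_norm_sub_sq (by positivity), ← ENNReal.ofReal_mul (by positivity),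
    show Real.pi / (1 / (2 * sigma t ^ 2)) = 2 * Real.pi * sigma t ^ 2 by field_simp,
    ← Real.rpow_add (by positivity), show -(d : ℝ) / 2 + d / 2 = 0 by ring]
  simp

/-- This exponential moment absorbs both the quadratic weight in the loss and the tail of the noise;
its price `2^{d/2}` is later beaten by `e^{-2d}`. -/
theorem lintegral_exp_mul_transitionDensity {d : ℕ} {t : ℝ} (ht : 0 < t) (x₀ : Vec d) :
    ∫⁻ x, ENNReal.ofReal (Real.exp (‖x - alpha t • x₀‖ ^ 2 / sigma t ^ 2 / 4) *
      transitionDensity t x₀ x) = ENNReal.ofReal (2 ^ ((d : ℝ) / 2)) := by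
  have hs := sigma_pos ht
  have h : ∀ x : Vec d, ENNReal.ofReal (Real.exp (‖x - alpha t • x₀‖ ^ 2 / sigma t ^ 2 / 4) *
      transitionDensity t x₀ x) =
      ENNReal.ofReal ((2 * Real.pi * sigma t ^ 2) ^ (-(d : ℝ) / 2)) *
        ENNReal.ofReal (Real.exp (-(1 / (4 * sigma t ^ 2)) * ‖x - alpha t • x₀‖ ^ 2)) := by
    intro x
    rw [← ENNReal.ofReal_mul (by positivity), transitionDensity, mul_left_comm, ← Real.exp_add]
    congr 3
    field_simp
    ring
  simp_rw [h]
  rw [lintegral_const_mul' _ _ ENNReal.ofReal_ne_top,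
    lintegral_exp_neg_mul_norm_sub_sq (by positivity), ← ENNReal.ofReal_mul (by positivity),
    show Real.pi / (1 / (4 * sigma t ^ 2)) = 2 * (2 * Real.pi * sigma t ^ 2) by field_simp; norm_num,
    Real.mul_rpow (x := 2) (by positivity) (by positivity), mul_left_comm,
    ← Real.rpow_add (by positivity), show -(d : ℝ) / 2 + d / 2 = 0 by ring]
  simp

/-- The score of `X_t` conditionally on `X_0 = x₀`. -/
noncomputable def condScore {d : ℕ} (t : ℝ) (x₀ x : Vec d) : Vec d :=
  -((sigma t ^ 2)⁻¹ • (x - alpha t • x₀))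

theorem continuous_condScore {d : ℕ} (t : ℝ) :
    Continuous fun p : Vec d × Vec d => condScore t p.1 p.2 := by
  unfold condScore
  fun_prop

theorem norm_condScore_sq {d : ℕ} (t : ℝ) (x₀ x : Vec d) :
    ‖condScore t x₀ x‖ ^ 2 = ‖x - alpha t • x₀‖ ^ 2 / sigma t ^ 2 / sigma t ^ 2 := by
  rw [condScore, norm_neg, norm_smul, mul_pow, Real.norm_eq_abs, sq_abs]
  ring

/-- Predicting the conditional score by `v` amounts to predicting `x₀` by `(x + σ²v)/α`, so a loss
bound becomes a small-ball bound in `x₀`. -/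
theorem norm_condScore_sub_sq {d : ℕ} {t : ℝ} (ht : 0 < t) (x₀ x v : Vec d) :
    ‖condScore t x₀ x - v‖ ^ 2 = (alpha t / sigma t ^ 2) ^ 2 *
      ‖x₀ - (alpha t)⁻¹ • (x + sigma t ^ 2 • v)‖ ^ 2 := by
  have hs := sigma_pos ht
  have ha := alpha_pos t
  have : condScore t x₀ x - v = (alpha t / sigma t ^ 2) •
      (x₀ - (alpha t)⁻¹ • (x + sigma t ^ 2 • v)) := by
    ext i
    simp only [condScore, PiLp.sub_apply, PiLp.add_apply, PiLp.neg_apply, PiLp.smul_apply,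
      smul_eq_mul]
    field_simp
    ring
  rw [this, norm_smul, mul_pow, Real.norm_eq_abs, sq_abs]

/-! ### Gaussian tilts: prior small balls and posterior error. -/

theorem exists_complete_square {d : ℕ} {C α s : ℝ} (hC : 0 < C) (hs : 0 < s) (μ x : Vec d) :
    ∃ (k : ℝ) (m : Vec d), ∀ y : Vec d, -C * ‖y - μ‖ ^ 2 / 2 + -‖x - α • y‖ ^ 2 / (2 * s) =
      k + -(C + α ^ 2 / s) * ‖y - m‖ ^ 2 / 2 := by
  have hθ : 0 < C + α ^ 2 / s := by positivity
  set θ := C + α ^ 2 / s with hθd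
  set m : Vec d := θ⁻¹ • (C • μ + (α / s) • x) with hm
  refine ⟨-C * ‖μ‖ ^ 2 / 2 - ‖x‖ ^ 2 / (2 * s) + θ * ‖m‖ ^ 2 / 2, m, fun y => ?_⟩
  have h : θ * inner ℝ y m = C * inner ℝ y μ + α / s * inner ℝ y x := by
    rw [hm, inner_smul_right, inner_add_right, inner_smul_right, inner_smul_right]
    field_simp
  rw [norm_sub_sq_real, norm_sub_sq_real, norm_sub_sq_real, norm_smul, inner_smul_right,
    mul_pow, Real.norm_eq_abs, sq_abs, real_inner_comm y x]
  have e1 : -θ * (‖y‖ ^ 2 - 2 * inner ℝ y m + ‖m‖ ^ 2) / 2 =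
    -θ * ‖y‖ ^ 2 / 2 + θ * inner ℝ y m - θ * ‖m‖ ^ 2 / 2 := by ring
  rw [e1, h, hθd]
  field_simp
  ring

/-- `P` has a density proportional to a Gaussian times a function with `GaussianDoubling`. -/
def IsGaussianTilt {d : ℕ} (C A : ℝ) (P : Measure (Vec d)) : Prop :=
  ∃ (w : ENNReal) (μ : Vec d) (g : Vec d → ℝ), GaussianDoubling A (C / 2) g ∧
    P = volume.withDensity fun x => w * ENNReal.ofReal (Real.exp (-C * ‖x - μ‖ ^ 2 / 2) * g x)

theorem IsGaussianTilt.measure_closedBall_le {d : ℕ} {C A q : ℝ} (hC : 0 < C) (hA : 0 < A)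
    (hq : 0 < q) {P : Measure (Vec d)} [IsProbabilityMeasure P] (hP : IsGaussianTilt C A P)
    (z : Vec d) : P (Metric.closedBall z (q * Real.sqrt d)) ≤
      ENNReal.ofReal (A ^ 2 * (2 * Real.exp 1 * C * q ^ 2) ^ ((d : ℝ) / 2)) := by
  obtain ⟨w, μ, g, hg, h⟩ := hP
  have hgm := hg.1
  have hmeas : Measurable fun x : Vec d =>
      ENNReal.ofReal (Real.exp (-C * ‖x - μ‖ ^ 2 / 2) * g x) := by fun_prop
  have hset : ∀ s, MeasurableSet s → P s =
      w * ∫⁻ x in s, ENNReal.ofReal (Real.exp (-C * ‖x - μ‖ ^ 2 / 2) * g x) := by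
    intro s hs
    rw [h, withDensity_apply _ hs, lintegral_const_mul _ hmeas]
  have h1 := hset _ MeasurableSet.univ
  rw [measure_univ, Measure.restrict_univ] at h1
  rw [hset _ Metric.isClosed_closedBall.measurableSet]
  calc _ ≤ w * (ENNReal.ofReal (A ^ 2 * (2 * Real.exp 1 * C * q ^ 2) ^ ((d : ℝ) / 2)) *
        ∫⁻ x, ENNReal.ofReal (Real.exp (-C * ‖x - μ‖ ^ 2 / 2) * g x)) := by
        gcongr
        exact hg.setLIntegral_closedBall_le hC le_rfl hA hq μ z
    _ = _ := by rw [mul_left_comm, ← h1, mul_one]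

/-- No estimator recovers the conditional score with a mean square error less than a multiple
of `d / σ²`. -/
theorem IsGaussianTilt.le_lintegral_condScore_sub {d : ℕ} {C A ε t : ℝ} (hC : 0 < C) (hA : 0 < A)
    (hε : 0 < ε) (ht : 0 < t) (hAε : A ^ 2 * (2 * Real.exp 1 * ε ^ 2) ^ ((d : ℝ) / 2) ≤ 1 / 2)
    {P : Measure (Vec d)} [IsProbabilityMeasure P] (hP : IsGaussianTilt C A P) (x v : Vec d) :
    ENNReal.ofReal ((alpha t / sigma t ^ 2) ^ 2 *
        (ε ^ 2 / (C + alpha t ^ 2 / sigma t ^ 2) * d) * (1 / 2)) *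
        ∫⁻ x₀, ENNReal.ofReal (transitionDensity t x₀ x) ∂P ≤
      ∫⁻ x₀, ENNReal.ofReal (‖condScore t x₀ x - v‖ ^ 2 * transitionDensity t x₀ x) ∂P := by
  obtain ⟨w, μ, g, hg, h⟩ := hP
  have hs := sigma_pos ht
  have hgm := hg.1
  obtain ⟨k, m, hkm⟩ := exists_complete_square (α := alpha t) hC (pow_pos hs 2) μ x
  set θ := C + alpha t ^ 2 / sigma t ^ 2 with hθd
  have hθ : C ≤ θ := le_add_of_nonneg_right (by positivity)
  have hθ0 : 0 < θ := hC.trans_le hθ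
  -- The radius is measured in posterior standard deviations, so `2eθq² = 2eε²` does not depend on
  -- `t`.
  set q := ε / Real.sqrt θ with hq
  have hq0 : 0 < q := by positivity
  have hq2 : q ^ 2 = ε ^ 2 / θ := by rw [hq, div_pow, Real.sq_sqrt hθ0.le]
  have hφm : Measurable fun x₀ : Vec d => ENNReal.ofReal (transitionDensity t x₀ x) := by
    unfold transitionDensity; fun_prop
  have hmeas : Measurable fun x : Vec d =>
      ENNReal.ofReal (Real.exp (-C * ‖x - μ‖ ^ 2 / 2) * g x) := by fun_prop
  have hmeas' : Measurable fun x : Vec d =>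
      ENNReal.ofReal (Real.exp (-θ * ‖x - m‖ ^ 2 / 2) * g x) := by fun_prop
  -- The unnormalised posterior is again a tilt of the same `g`. The constant `W` stays implicit
  -- because only ratios to the total mass `T` matter.
  obtain ⟨W, hset⟩ : ∃ W : ENNReal, ∀ s, MeasurableSet s →
      ∫⁻ x₀ in s, ENNReal.ofReal (transitionDensity t x₀ x) ∂P =
      W * ∫⁻ x in s, ENNReal.ofReal (Real.exp (-θ * ‖x - m‖ ^ 2 / 2) * g x) := by
    set κ : ℝ := (2 * Real.pi * sigma t ^ 2) ^ (-(d : ℝ) / 2) * Real.exp k with hκ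
    refine ⟨w * ENNReal.ofReal κ, fun s hs => ?_⟩
    rw [h, setLIntegral_withDensity_eq_setLIntegral_mul _ (by fun_prop) hφm hs,
      ← lintegral_const_mul _ hmeas']
    refine lintegral_congr fun y => ?_
    simp only [Pi.mul_apply]
    have hgy := hg.2.1 y
    rw [mul_assoc, mul_assoc, ← ENNReal.ofReal_mul (by positivity),
      ← ENNReal.ofReal_mul (by positivity)]
    congr 2
    rw [transitionDensity, hκ]
    have e := congrArg Real.exp (hkm y)
    rw [Real.exp_add, Real.exp_add] at e
    calc _ = (2 * Real.pi * sigma t ^ 2) ^ (-(d : ℝ) / 2) * (Real.exp (-C * ‖y - μ‖ ^ 2 / 2) *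
          Real.exp (-‖x - alpha t • y‖ ^ 2 / (2 * sigma t ^ 2))) * g y := by ring
      _ = _ := by rw [e]; ring
  set T := ∫⁻ x₀, ENNReal.ofReal (transitionDensity t x₀ x) ∂P with hT
  have hTfin : T ≠ ⊤ := by
    refine ne_top_of_le_ne_top ?_ (lintegral_mono fun x₀ =>
      ENNReal.ofReal_le_ofReal (transitionDensity_le (t := t) x₀ x))
    simp
  set m' := (alpha t)⁻¹ • (x + sigma t ^ 2 • v) with hm'
  set B := Metric.closedBall m' (q * Real.sqrt d) with hBd
  have hBm : MeasurableSet B := Metric.isClosed_closedBall.measurableSet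
  have hball : ∫⁻ x₀ in B, ENNReal.ofReal (transitionDensity t x₀ x) ∂P ≤
      ENNReal.ofReal (1 / 2) * T := by
    have hu := hset _ MeasurableSet.univ
    rw [Measure.restrict_univ, Measure.restrict_univ, ← hT] at hu
    rw [hset B hBm]
    calc _ ≤ W * (ENNReal.ofReal (A ^ 2 * (2 * Real.exp 1 * θ * q ^ 2) ^ ((d : ℝ) / 2)) *
          ∫⁻ x, ENNReal.ofReal (Real.exp (-θ * ‖x - m‖ ^ 2 / 2) * g x)) := by
          gcongr
          exact hg.setLIntegral_closedBall_le hC hθ hA hq0 m m'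
      _ = ENNReal.ofReal (A ^ 2 * (2 * Real.exp 1 * θ * q ^ 2) ^ ((d : ℝ) / 2)) * T := by
          rw [mul_left_comm, ← hu]
      _ ≤ _ := by
          gcongr
          rwa [mul_assoc _ θ, hq2, mul_div_cancel₀ _ hθ0.ne']
  -- At least half of the posterior mass lies outside the ball around the guess `m'`, where the
  -- squared error exceeds `q² d`.
  have hcompl : ENNReal.ofReal (1 / 2) * T ≤
      ∫⁻ x₀ in Bᶜ, ENNReal.ofReal (transitionDensity t x₀ x) ∂P := by
    have hsum := lintegral_add_compl (μ := P)
      (fun x₀ => ENNReal.ofReal (transitionDensity t x₀ x)) hBm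
    have hT2 : T = ENNReal.ofReal (1 / 2) * T + ENNReal.ofReal (1 / 2) * T := by
      rw [← add_mul, ← ENNReal.ofReal_add (by norm_num) (by norm_num)]
      norm_num
    have hfin : ENNReal.ofReal (1 / 2) * T ≠ ⊤ := ENNReal.mul_ne_top ENNReal.ofReal_ne_top hTfin
    refine (ENNReal.add_le_add_iff_left hfin).1 ?_
    calc _ = _ := hT2.symm
      _ = _ := hsum.symm
      _ ≤ _ := by gcongr
  calc _ = ENNReal.ofReal ((alpha t / sigma t ^ 2) ^ 2 * (ε ^ 2 / θ * d)) *
        (ENNReal.ofReal (1 / 2) * T) := by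
        rw [ENNReal.ofReal_mul (by positivity), mul_assoc]
    _ ≤ ENNReal.ofReal ((alpha t / sigma t ^ 2) ^ 2 * (ε ^ 2 / θ * d)) *
        ∫⁻ x₀ in Bᶜ, ENNReal.ofReal (transitionDensity t x₀ x) ∂P := by gcongr
    _ = ∫⁻ x₀ in Bᶜ, ENNReal.ofReal ((alpha t / sigma t ^ 2) ^ 2 * (ε ^ 2 / θ * d)) *
        ENNReal.ofReal (transitionDensity t x₀ x) ∂P := (lintegral_const_mul _ hφm).symm
    _ ≤ ∫⁻ x₀ in Bᶜ, ENNReal.ofReal (‖condScore t x₀ x - v‖ ^ 2 * transitionDensity t x₀ x) ∂P := by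
        refine setLIntegral_mono' hBm.compl fun x₀ hx₀ => ?_
        rw [← ENNReal.ofReal_mul (by positivity), norm_condScore_sub_sq ht]
        have hφ := (transitionDensity_pos ht x₀ x).le
        gcongr
        rw [hBd, Set.mem_compl_iff, Metric.mem_closedBall, not_le, dist_eq_norm] at hx₀
        calc ε ^ 2 / θ * d = (q * Real.sqrt d) ^ 2 := by
              rw [mul_pow, hq2, Real.sq_sqrt (Nat.cast_nonneg d)]
          _ ≤ _ := by gcongr
    _ ≤ _ := setLIntegral_le_lintegral _ _

/-! ### Components as Gaussian tilts, and their mixture. -/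

theorem ComponentAssumption.isProbabilityMeasure_componentLaw {d : ℕ}
    {C cf β B C₁ C₂ C₃ R : ℝ} {μ : Vec d} {S : Matrix (Fin d) (Fin d) ℝ} {ν : Measure (Vec d)}
    (h : ComponentAssumption C cf β B C₁ C₂ C₃ R μ S ν) :
    IsProbabilityMeasure (componentLaw μ S ν) := by
  have := h.isProbabilityMeasure
  have : IsProbabilityMeasure (noiseLaw S ν) :=
    Measure.isProbabilityMeasure_map (ContinuousLinearMap.measurable _).aemeasurable
  exact Measure.isProbabilityMeasure_map (by fun_prop)

theorem map_add_left_withDensity {d : ℕ} (μ : Vec d) {h : Vec d → ENNReal} (hh : Measurable h) :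
    (volume.withDensity h).map (fun z => μ + z) = volume.withDensity fun x => h (x - μ) := by
  ext s hs
  have hm : Measurable fun z : Vec d => μ + z := by fun_prop
  rw [Measure.map_apply hm hs, withDensity_apply _ (hm hs), withDensity_apply _ hs,
    ← (measurePreserving_add_left volume μ).setLIntegral_comp_preimage hs (by fun_prop)]
  simp

theorem ComponentAssumption.isGaussianTilt {d : ℕ} {A C cf β B C₁ C₂ C₃ R : ℝ} {μ : Vec d}
    {S : Matrix (Fin d) (Fin d) ℝ} {ν : Measure (Vec d)} (hcf : 0 < cf)
    (hA : ∀ f : Vec d → ℝ, f ∈ holderBall d β B → (∀ x, cf ≤ f x) → GaussianDoubling A (C / 2) f)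
    (h : ComponentAssumption C cf β B C₁ C₂ C₃ R μ S ν) :
    IsGaussianTilt C A (componentLaw μ S ν) := by
  obtain ⟨p, ⟨f, hf, hlow, hp⟩, hnoise⟩ := h.density
  have hfd := hA f hf hlow
  set Z := ∫ y : Vec d, Real.exp (-C * ‖y‖ ^ 2 / 2) * f y
  have hfm := hfd.1
  have hpm : Measurable fun x => ENNReal.ofReal (p x) := by
    simp_rw [hp]
    fun_prop
  refine ⟨ENNReal.ofReal Z⁻¹, μ, _, hfd.comp_sub μ, ?_⟩
  rw [componentLaw, hnoise, map_add_left_withDensity μ hpm]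
  congr 1
  ext x
  rw [hp, div_eq_mul_inv, ENNReal.ofReal_mul, mul_comm]
  exact mul_nonneg (Real.exp_pos _).le (hcf.le.trans (hlow _))

section Mixture

variable {d K : ℕ} {μ : Fin K → Vec d} {S : Matrix (Fin d) (Fin d) ℝ} {ν : Fin K → Measure (Vec d)}

theorem lintegral_mixtureLaw (f : Vec d → ENNReal) :
    ∫⁻ x, f x ∂(mixtureLaw μ S ν) =
      (K : ENNReal)⁻¹ * ∑ k, ∫⁻ x, f x ∂(componentLaw (μ k) S (ν k)) := by
  rw [mixtureLaw, lintegral_smul_measure, lintegral_finsetSum_measure, smul_eq_mul]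

theorem isProbabilityMeasure_mixtureLaw (hK : 1 ≤ K)
    (h : ∀ k, IsProbabilityMeasure (componentLaw (μ k) S (ν k))) :
    IsProbabilityMeasure (mixtureLaw μ S ν) := by
  constructor
  rw [← lintegral_one, lintegral_mixtureLaw]
  simp only [lintegral_one, measure_univ, Finset.sum_const, Finset.card_univ, Fintype.card_fin,
    nsmul_eq_mul, mul_one]
  exact ENNReal.inv_mul_cancel (by simp; omega) (ENNReal.natCast_ne_top K)

end Mixture

/-! ### The score as a posterior mean. -/

section Score

variable {d : ℕ} {t : ℝ}

/-- From `w e^{-w/2} ≤ 2`. Being uniform in `x₀` and `x`, the bound gives integrability against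
every probability measure, without moment conditions. -/
theorem norm_condScore_sq_mul_transitionDensity_le (ht : 0 < t) (x₀ x : Vec d) :
    ‖condScore t x₀ x‖ ^ 2 * transitionDensity t x₀ x ≤
      2 / sigma t ^ 2 * (2 * Real.pi * sigma t ^ 2) ^ (-(d : ℝ) / 2) := by
  have hs := sigma_pos ht
  rw [norm_condScore_sq, transitionDensity]
  set w := ‖x - alpha t • x₀‖ ^ 2 / sigma t ^ 2 with hw
  have h1 : -‖x - alpha t • x₀‖ ^ 2 / (2 * sigma t ^ 2) = -(w / 2) := by
    rw [hw]; field_simp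
  have h2 : w * Real.exp (-(w / 2)) ≤ 2 := by
    rw [Real.exp_neg, ← div_eq_mul_inv, div_le_iff₀ (Real.exp_pos _)]
    linarith [Real.add_one_le_exp (w / 2)]
  rw [h1]
  calc _ = (w * Real.exp (-(w / 2))) / sigma t ^ 2 *
        (2 * Real.pi * sigma t ^ 2) ^ (-(d : ℝ) / 2) := by ring
    _ ≤ _ := by gcongr

theorem norm_condScore_mul_transitionDensity_le (ht : 0 < t) (x₀ x : Vec d) :
    ‖transitionDensity t x₀ x • condScore t x₀ x‖ ≤
      (1 + 2 / sigma t ^ 2) * (2 * Real.pi * sigma t ^ 2) ^ (-(d : ℝ) / 2) := by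
  have h1 := norm_condScore_sq_mul_transitionDensity_le ht x₀ x
  have h2 := transitionDensity_le (t := t) x₀ x
  have h3 := transitionDensity_pos ht x₀ x
  rw [norm_smul, Real.norm_eq_abs, abs_of_pos h3]
  nlinarith [mul_nonneg h3.le (sq_nonneg (‖condScore t x₀ x‖ - 1)),
    mul_nonneg h3.le (sq_nonneg (‖condScore t x₀ x‖))]

theorem continuous_transitionDensity_left (x : Vec d) :
    Continuous fun x₀ => transitionDensity t x₀ x := by
  unfold transitionDensity; fun_prop

theorem continuous_condScore_left (x : Vec d) : Continuous fun x₀ => condScore t x₀ x := by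
  unfold condScore; fun_prop

variable (Q : Measure (Vec d)) [IsProbabilityMeasure Q]

theorem integrable_transitionDensity (ht : 0 < t) (x : Vec d) :
    Integrable (fun x₀ => transitionDensity t x₀ x) Q :=
  .of_bound (continuous_transitionDensity_left x).aestronglyMeasurable
    ((2 * Real.pi * sigma t ^ 2) ^ (-(d : ℝ) / 2)) <| .of_forall fun x₀ => by
      rw [Real.norm_eq_abs, abs_of_pos (transitionDensity_pos ht _ _)]
      exact transitionDensity_le x₀ x

theorem integrable_transitionDensity_smul_condScore (ht : 0 < t) (x : Vec d) :
    Integrable (fun x₀ => transitionDensity t x₀ x • condScore t x₀ x) Q :=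
  .of_bound ((continuous_transitionDensity_left x).smul
    (continuous_condScore_left x)).aestronglyMeasurable _ <|
      .of_forall fun x₀ => norm_condScore_mul_transitionDensity_le ht x₀ x

theorem integrable_norm_condScore_sq (ht : 0 < t) (x : Vec d) :
    Integrable (fun x₀ => ‖condScore t x₀ x‖ ^ 2 * transitionDensity t x₀ x) Q :=
  .of_bound (((continuous_condScore_left x).norm.pow 2).mul
    (continuous_transitionDensity_left x)).aestronglyMeasurable _ <|
      .of_forall fun x₀ => by
        rw [Real.norm_eq_abs, abs_of_nonneg
          (mul_nonneg (by positivity) (transitionDensity_pos ht _ _).le)]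
        exact norm_condScore_sq_mul_transitionDensity_le ht x₀ x

theorem marginalDensity_pos (ht : 0 < t) (x : Vec d) : 0 < marginalDensity t Q x := by
  rw [marginalDensity, integral_pos_iff_support_of_nonneg
    (fun x₀ => (transitionDensity_pos ht x₀ x).le) (integrable_transitionDensity Q ht x)]
  have : Function.support (fun x₀ => transitionDensity t x₀ x) = Set.univ :=
    Set.eq_univ_of_forall fun x₀ => (transitionDensity_pos ht x₀ x).ne'
  simp [this]

theorem hasFDerivAt_transitionDensity (ht : 0 < t) (x₀ x : Vec d) :
    HasFDerivAt (fun y => transitionDensity t x₀ y)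
      (innerSL ℝ (transitionDensity t x₀ x • condScore t x₀ x)) x := by
  have hs := sigma_pos ht
  have h1 : HasFDerivAt (fun y : Vec d => ‖y - alpha t • x₀‖ ^ 2)
      (2 • (innerSL ℝ (x - alpha t • x₀)).comp (ContinuousLinearMap.id ℝ (Vec d))) x :=
    ((hasFDerivAt_id x).sub_const _).norm_sq
  have h2 := ((h1.const_mul (-(2 * sigma t ^ 2)⁻¹)).exp).const_mul
    ((2 * Real.pi * sigma t ^ 2) ^ (-(d : ℝ) / 2))
  have he : ∀ y : Vec d, -(2 * sigma t ^ 2)⁻¹ * ‖y - alpha t • x₀‖ ^ 2 =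
    -‖y - alpha t • x₀‖ ^ 2 / (2 * sigma t ^ 2) := fun y => by ring
  simp only [he] at h2
  refine h2.congr_fderiv ?_
  ext v
  simp only [transitionDensity, condScore, map_smul, map_neg, smul_apply,
    ContinuousLinearMap.comp_id, smul_eq_mul, innerSL_apply_apply, nsmul_eq_mul]
  simp [-map_sub]
  field_simp

/-- Differentiation under the integral; the dominating function is a constant, so no localisation
around `x` is required. -/
theorem hasGradientAt_marginalDensity (ht : 0 < t) (x : Vec d) :
    HasGradientAt (marginalDensity t Q)
      (∫ x₀, transitionDensity t x₀ x • condScore t x₀ x ∂Q) x := by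
  have hF' : Continuous fun x₀ : Vec d =>
      innerSL ℝ (transitionDensity t x₀ x • condScore t x₀ x) :=
    (innerSL ℝ).continuous.comp
      ((continuous_transitionDensity_left x).smul (continuous_condScore_left x))
  have key := hasFDerivAt_integral_of_dominated_of_fderiv_le (𝕜 := ℝ) (μ := Q)
    (F := fun y x₀ => transitionDensity t x₀ y)
    (F' := fun y x₀ => innerSL ℝ (transitionDensity t x₀ y • condScore t x₀ y))
    (bound := fun _ => (1 + 2 / sigma t ^ 2) * (2 * Real.pi * sigma t ^ 2) ^ (-(d : ℝ) / 2))
    (x₀ := x) Filter.univ_mem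
    (.of_forall fun y => (continuous_transitionDensity_left y).aestronglyMeasurable)
    (integrable_transitionDensity Q ht x) hF'.aestronglyMeasurable
    (.of_forall fun x₀ y _ => by
      rw [innerSL_apply_norm]
      exact norm_condScore_mul_transitionDensity_le ht x₀ y)
    (integrable_const _)
    (.of_forall fun x₀ y _ => hasFDerivAt_transitionDensity ht x₀ y)
  rw [hasGradientAt_iff_hasFDerivAt]
  refine key.congr_fderiv ?_
  have hint : Integrable (fun x₀ : Vec d =>
      innerSL ℝ (transitionDensity t x₀ x • condScore t x₀ x)) Q :=
    .of_bound hF'.aestronglyMeasurable _ (.of_forall fun x₀ => by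
      rw [innerSL_apply_norm]
      exact norm_condScore_mul_transitionDensity_le ht x₀ x)
  ext v
  rw [ContinuousLinearMap.integral_apply hint, InnerProductSpace.toDual_apply_apply,
    real_inner_comm, ← integral_inner (integrable_transitionDensity_smul_condScore Q ht x)]
  simp only [innerSL_apply_apply]
  exact integral_congr_ae (.of_forall fun x₀ => real_inner_comm _ _)

/-- Tweedie's formula. -/
theorem score_eq (ht : 0 < t) (x : Vec d) :
    score t Q x = (marginalDensity t Q x)⁻¹ •
      ∫ x₀, transitionDensity t x₀ x • condScore t x₀ x ∂Q := by
  have h := (hasGradientAt_marginalDensity Q ht x).hasFDerivAt.log (marginalDensity_pos Q ht x).ne'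
  refine HasGradientAt.gradient ?_
  rw [hasGradientAt_iff_hasFDerivAt]
  refine h.congr_fderiv ?_
  simp

/-- Orthogonality: the residual about a posterior mean has mean zero. This removes the cross term in
the best-approximation property. -/
theorem integral_transitionDensity_smul_condScore_sub_score (ht : 0 < t) (x : Vec d) :
    ∫ x₀, transitionDensity t x₀ x • (condScore t x₀ x - score t Q x) ∂Q = 0 := by
  simp_rw [smul_sub]
  rw [integral_sub (integrable_transitionDensity_smul_condScore Q ht x)
    ((integrable_transitionDensity Q ht x).smul_const _), integral_smul_const, score_eq Q ht,
    smul_smul]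
  change _ - (marginalDensity t Q x * (marginalDensity t Q x)⁻¹) • _ = _
  rw [mul_inv_cancel₀ (marginalDensity_pos Q ht x).ne', one_smul, sub_self]

theorem integrable_norm_condScore_sub_sq (ht : 0 < t) (x v : Vec d) :
    Integrable (fun x₀ => ‖condScore t x₀ x - v‖ ^ 2 * transitionDensity t x₀ x) Q := by
  refine Integrable.mono' (((integrable_norm_condScore_sq Q ht x).add
    ((integrable_transitionDensity Q ht x).const_mul (‖v‖ ^ 2))).const_mul 2)
    ((((continuous_condScore_left x).sub continuous_const).norm.pow 2).mul
      (continuous_transitionDensity_left x)).aestronglyMeasurable (.of_forall fun x₀ => ?_)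
  have hφ := (transitionDensity_pos ht x₀ x).le
  rw [Real.norm_eq_abs, abs_of_nonneg (by positivity)]
  have h1 : ‖condScore t x₀ x - v‖ ^ 2 ≤ 2 * (‖condScore t x₀ x‖ ^ 2 + ‖v‖ ^ 2) := by
    have := norm_sub_le (condScore t x₀ x) v
    nlinarith [norm_nonneg (condScore t x₀ x - v), sq_nonneg (‖condScore t x₀ x‖ - ‖v‖)]
  simp only [Pi.add_apply]
  nlinarith

/-- The score is the best approximation of the conditional score. -/
theorem lintegral_condScore_sub_score_le (ht : 0 < t) (x v : Vec d) :
    ∫⁻ x₀, ENNReal.ofReal (‖condScore t x₀ x - score t Q x‖ ^ 2 * transitionDensity t x₀ x) ∂Q ≤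
      ∫⁻ x₀, ENNReal.ofReal (‖condScore t x₀ x - v‖ ^ 2 * transitionDensity t x₀ x) ∂Q := by
  have hnn : ∀ v x₀, 0 ≤ ‖condScore t x₀ x - v‖ ^ 2 * transitionDensity t x₀ x := fun v x₀ =>
    mul_nonneg (by positivity) (transitionDensity_pos ht x₀ x).le
  rw [← ofReal_integral_eq_lintegral_ofReal (integrable_norm_condScore_sub_sq Q ht x _)
      (.of_forall (hnn _)),
    ← ofReal_integral_eq_lintegral_ofReal (integrable_norm_condScore_sub_sq Q ht x v)
      (.of_forall (hnn _))]
  apply ENNReal.ofReal_le_ofReal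
  set s := score t Q x with hs
  have hi : Integrable (fun x₀ => transitionDensity t x₀ x • (condScore t x₀ x - s)) Q := by
    simp_rw [smul_sub]
    exact (integrable_transitionDensity_smul_condScore Q ht x).sub
      ((integrable_transitionDensity Q ht x).smul_const _)
  -- Adding this vanishing cross term makes the comparison pointwise in `x₀`, with difference
  -- `transitionDensity t x₀ x * ‖s - v‖²`.
  have h0 : ∫ x₀, inner ℝ (2 • (s - v)) (transitionDensity t x₀ x • (condScore t x₀ x - s)) ∂Q
      = 0 := by
    rw [integral_inner hi, integral_transitionDensity_smul_condScore_sub_score Q ht,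
      inner_zero_right]
  calc ∫ x₀, ‖condScore t x₀ x - s‖ ^ 2 * transitionDensity t x₀ x ∂Q
      = ∫ x₀, ‖condScore t x₀ x - s‖ ^ 2 * transitionDensity t x₀ x +
        inner ℝ (2 • (s - v)) (transitionDensity t x₀ x • (condScore t x₀ x - s)) ∂Q := by
        rw [integral_add (integrable_norm_condScore_sub_sq Q ht x s) (hi.const_inner _), h0,
          add_zero]
    _ ≤ _ := by
        refine integral_mono ((integrable_norm_condScore_sub_sq Q ht x s).add (hi.const_inner _))
          (integrable_norm_condScore_sub_sq Q ht x v) fun x₀ => ?_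
        have hφ := (transitionDensity_pos ht x₀ x).le
        have e : condScore t x₀ x - v = (condScore t x₀ x - s) + (s - v) := by abel
        have e2 : inner ℝ (2 • (s - v)) (transitionDensity t x₀ x • (condScore t x₀ x - s)) =
            transitionDensity t x₀ x * (2 * inner ℝ (condScore t x₀ x - s) (s - v)) := by
          rw [two_nsmul, ← two_smul ℝ, real_inner_smul_left, real_inner_smul_right,
            real_inner_comm]
          ring
        simp only []
        rw [e2, e, norm_add_sq_real]
        nlinarith [mul_nonneg hφ (sq_nonneg ‖s - v‖)]

theorem measurable_score (ht : 0 < t) : Measurable (score t Q) := by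
  have hφ : Continuous fun p : Vec d × Vec d => transitionDensity t p.2 p.1 := by
    unfold transitionDensity; fun_prop
  have hu : Continuous fun p : Vec d × Vec d => condScore t p.2 p.1 := by
    unfold condScore; fun_prop
  have h1 : Measurable (marginalDensity t Q) :=
    (hφ.stronglyMeasurable.integral_prod_right' (ν := Q)).measurable
  have h2 : Measurable fun x => ∫ x₀, transitionDensity t x₀ x • condScore t x₀ x ∂Q :=
    ((hφ.smul hu).stronglyMeasurable.integral_prod_right' (ν := Q)).measurable
  rw [show score t Q = _ from funext (score_eq Q ht)]
  exact h1.inv.smul h2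

end Score

/-! ### The loss as an extended integral. -/

/-- The denoising loss with values in `[0, ∞]`. -/
noncomputable def edenoisingLoss {d : ℕ} (t : ℝ) (x₀ : Vec d) (s : Vec d → Vec d) : ENNReal :=
  ∫⁻ x, ENNReal.ofReal (‖condScore t x₀ x - s x‖ ^ 2 * transitionDensity t x₀ x)

section Loss

variable {d : ℕ} {t : ℝ}

theorem continuous_transitionDensity_right (x₀ : Vec d) :
    Continuous fun x => transitionDensity t x₀ x := by
  unfold transitionDensity; fun_prop

theorem continuous_condScore_right (x₀ : Vec d) : Continuous fun x => condScore t x₀ x := by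
  unfold condScore; fun_prop

/-- No finiteness is needed: for an infinite loss both sides are `0`. -/
theorem denoisingLoss_eq_toReal (ht : 0 < t) (x₀ : Vec d) {s : Vec d → Vec d}
    (hs : Measurable s) : denoisingLoss t x₀ s = (edenoisingLoss t x₀ s).toReal := by
  have hφ : Measurable fun x => transitionDensity t x₀ x :=
    (continuous_transitionDensity_right x₀).measurable
  have hu : Measurable fun x => condScore t x₀ x := (continuous_condScore_right x₀).measurable
  rw [denoisingLoss, transitionLaw, integral_withDensity_eq_integral_toReal_smul
    hφ.ennreal_ofReal (.of_forall fun _ => ENNReal.ofReal_lt_top)]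
  have e : ∀ x, (ENNReal.ofReal (transitionDensity t x₀ x)).toReal •
      ‖-((sigma t ^ 2)⁻¹ • (x - alpha t • x₀)) - s x‖ ^ 2 =
      ‖condScore t x₀ x - s x‖ ^ 2 * transitionDensity t x₀ x := fun x => by
    rw [ENNReal.toReal_ofReal (transitionDensity_pos ht _ _).le, smul_eq_mul, mul_comm, condScore]
  simp_rw [e]
  have hm : Measurable fun x => ‖condScore t x₀ x - s x‖ ^ 2 * transitionDensity t x₀ x :=
    ((hu.sub hs).norm.pow_const 2).mul hφ
  rw [integral_eq_lintegral_of_nonneg_ae (.of_forall fun x =>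
    mul_nonneg (by positivity) (transitionDensity_pos ht _ _).le)
    hm.aestronglyMeasurable, edenoisingLoss]

theorem measurable_lossIntegrand {s : Vec d → Vec d} (hs : Measurable s) :
    Measurable fun p : Vec d × Vec d =>
      ENNReal.ofReal (‖condScore t p.1 p.2 - s p.2‖ ^ 2 * transitionDensity t p.1 p.2) :=
  ENNReal.measurable_ofReal.comp (((((continuous_condScore t).measurable.sub
    (hs.comp measurable_snd)).norm.pow_const 2)).mul (continuous_transitionDensity t).measurable)

theorem measurable_edenoisingLoss {s : Vec d → Vec d} (hs : Measurable s) :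
    Measurable fun x₀ => edenoisingLoss t x₀ s :=
  (measurable_lossIntegrand hs).lintegral_prod_right'

/-- Tonelli puts the integral over `x₀` inside, where the comparisons for fixed `x` apply. -/
theorem lintegral_edenoisingLoss (Q : Measure (Vec d)) [SFinite Q] {s : Vec d → Vec d}
    (hs : Measurable s) : ∫⁻ x₀, edenoisingLoss t x₀ s ∂Q =
      ∫⁻ x, ∫⁻ x₀, ENNReal.ofReal
        (‖condScore t x₀ x - s x‖ ^ 2 * transitionDensity t x₀ x) ∂Q :=
  lintegral_lintegral_swap (measurable_lossIntegrand hs).aemeasurable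

/-- The rate `1/8` is half of that in the exponential moment; the other half pays for the tail
event. -/
theorem norm_condScore_sq_le_exp (ht : 0 < t) (x₀ x : Vec d) :
    ‖condScore t x₀ x‖ ^ 2 ≤
      8 / sigma t ^ 2 * Real.exp (‖x - alpha t • x₀‖ ^ 2 / sigma t ^ 2 / 8) := by
  have hs := sigma_pos ht
  rw [norm_condScore_sq]
  have h := Real.add_one_le_exp (‖x - alpha t • x₀‖ ^ 2 / sigma t ^ 2 / 8)
  rw [div_mul_eq_mul_div]
  gcongr
  linarith

theorem edenoisingLoss_zero_le (ht : 0 < t) (x₀ : Vec d) :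
    edenoisingLoss t x₀ (fun _ => 0) ≤ ENNReal.ofReal (8 / sigma t ^ 2 * 2 ^ ((d : ℝ) / 2)) := by
  have hs := sigma_pos ht
  rw [ENNReal.ofReal_mul (by positivity), ← lintegral_exp_mul_transitionDensity ht x₀,
    ← lintegral_const_mul' _ _ ENNReal.ofReal_ne_top]
  refine lintegral_mono fun x => ?_
  rw [← ENNReal.ofReal_mul (by positivity), ← mul_assoc, sub_zero]
  have hφ := (transitionDensity_pos ht x₀ x).le
  gcongr
  refine (norm_condScore_sq_le_exp ht x₀ x).trans ?_
  gcongr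
  norm_num

section Population

variable (Q : Measure (Vec d)) [IsProbabilityMeasure Q]

/-- Comparison with the zero predictor, whose loss is bounded uniformly in `x₀`. -/
theorem lintegral_edenoisingLoss_score_lt_top (ht : 0 < t) :
    ∫⁻ x₀, edenoisingLoss t x₀ (score t Q) ∂Q < ⊤ := by
  calc ∫⁻ x₀, edenoisingLoss t x₀ (score t Q) ∂Q
      ≤ ∫⁻ x₀, edenoisingLoss t x₀ (fun _ => 0) ∂Q := by
        rw [lintegral_edenoisingLoss Q (measurable_score Q ht),
          lintegral_edenoisingLoss Q measurable_const]
        exact lintegral_mono fun x => lintegral_condScore_sub_score_le Q ht x 0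
    _ ≤ ∫⁻ _, ENNReal.ofReal (8 / sigma t ^ 2 * 2 ^ ((d : ℝ) / 2)) ∂Q :=
        lintegral_mono fun x₀ => edenoisingLoss_zero_le ht x₀
    _ < ⊤ := by simp

theorem integrable_denoisingLoss_score (ht : 0 < t) :
    Integrable (fun x₀ => denoisingLoss t x₀ (score t Q)) Q := by
  simp_rw [denoisingLoss_eq_toReal ht _ (measurable_score Q ht)]
  exact integrable_toReal_of_lintegral_ne_top
    (measurable_edenoisingLoss (measurable_score Q ht)).aemeasurable
    (lintegral_edenoisingLoss_score_lt_top Q ht).ne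

theorem integral_denoisingLoss_score (ht : 0 < t) :
    ∫ x₀, denoisingLoss t x₀ (score t Q) ∂Q =
      (∫⁻ x₀, edenoisingLoss t x₀ (score t Q) ∂Q).toReal := by
  simp_rw [denoisingLoss_eq_toReal ht _ (measurable_score Q ht)]
  exact integral_toReal (measurable_edenoisingLoss (measurable_score Q ht)).aemeasurable
    (ae_lt_top (measurable_edenoisingLoss (measurable_score Q ht))
      (lintegral_edenoisingLoss_score_lt_top Q ht).ne)

/-- Integrating the hypothesis over `x` at `v = score t Q x` gives the claim, since the transition
densities have mass one. -/
theorem le_integral_denoisingLoss_score (ht : 0 < t) {c : ℝ}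
    (h : ∀ x v, ENNReal.ofReal c * ∫⁻ x₀, ENNReal.ofReal (transitionDensity t x₀ x) ∂Q ≤
      ∫⁻ x₀, ENNReal.ofReal (‖condScore t x₀ x - v‖ ^ 2 * transitionDensity t x₀ x) ∂Q) :
    c ≤ ∫ x₀, denoisingLoss t x₀ (score t Q) ∂Q := by
  rw [integral_denoisingLoss_score Q ht,
    ← ENNReal.ofReal_le_iff_le_toReal (lintegral_edenoisingLoss_score_lt_top Q ht).ne,
    lintegral_edenoisingLoss Q (measurable_score Q ht)]
  have hm : Measurable fun p : Vec d × Vec d => ENNReal.ofReal (transitionDensity t p.1 p.2) :=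
    (continuous_transitionDensity t).measurable.ennreal_ofReal
  calc ENNReal.ofReal c
      = ENNReal.ofReal c *
        ∫⁻ x₀, (∫⁻ x, ENNReal.ofReal (transitionDensity t x₀ x)) ∂Q := by
        simp [lintegral_transitionDensity ht]
    _ = ENNReal.ofReal c *
        ∫⁻ x, ∫⁻ x₀, ENNReal.ofReal (transitionDensity t x₀ x) ∂Q := by
        rw [lintegral_lintegral_swap (f := fun x₀ x => ENNReal.ofReal (transitionDensity t x₀ x))
          hm.aemeasurable]
    _ = ∫⁻ x, ENNReal.ofReal c * ∫⁻ x₀, ENNReal.ofReal (transitionDensity t x₀ x) ∂Q :=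
        (lintegral_const_mul' _ _ ENNReal.ofReal_ne_top).symm
    _ ≤ _ := lintegral_mono fun x => h x _

end Population

/-! ### The empirical score: estimator, neighbours, and the gap. -/

section Empirical

variable {n : ℕ}

/-- Some other data point is within distance `ρ` of the `i`-th one. -/
def HasNeighbor (ρ : ℝ) (D : Fin n → Vec d) (i : Fin n) : Prop :=
  ∃ j, j ≠ i ∧ ‖D i - D j‖ ≤ ρ

theorem lintegral_empiricalLaw (D : Fin n → Vec d) (f : Vec d → ENNReal) :
    ∫⁻ x, f x ∂(empiricalLaw D) = (n : ENNReal)⁻¹ * ∑ i, f (D i) := by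
  rw [empiricalLaw, lintegral_smul_measure, lintegral_finsetSum_measure, smul_eq_mul]
  simp

theorem integral_empiricalLaw {E : Type*} [NormedAddCommGroup E] [NormedSpace ℝ E]
    [CompleteSpace E] (D : Fin n → Vec d) (f : Vec d → E) :
    ∫ x, f x ∂(empiricalLaw D) = (n : ℝ)⁻¹ • ∑ i, f (D i) := by
  rw [empiricalLaw, integral_smul_measure, integral_finsetSum_measure]
  · simp
  · exact fun i _ => integrable_dirac (by simp)

theorem isProbabilityMeasure_empiricalLaw (hn : 1 ≤ n) (D : Fin n → Vec d) :
    IsProbabilityMeasure (empiricalLaw D) := by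
  constructor
  rw [← lintegral_one, lintegral_empiricalLaw]
  simp only [Finset.sum_const, Finset.card_univ, Fintype.card_fin, nsmul_eq_mul, mul_one]
  exact ENNReal.inv_mul_cancel (by simp; omega) (ENNReal.natCast_ne_top n)

/-- Projecting on the only data point near `x / α`, if there is just one, is a good estimator. -/
theorem exists_estimator (ht : 0 < t) (D : Fin n → Vec d) (x : Vec d) :
    ∃ v, ∀ i, ‖condScore t (D i) x - v‖ ^ 2 ≤ ‖condScore t (D i) x‖ ^ 2 *
      (4 * (if 16 * d < ‖x - alpha t • D i‖ ^ 2 / sigma t ^ 2 then 1 else 0) +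
        {D | HasNeighbor (8 * sigma t / alpha t * Real.sqrt d) D i}.indicator 1 D) := by
  have hs := sigma_pos ht
  have ha := alpha_pos t
  have hind : ∀ i, (0 : ℝ) ≤
      {D : Fin n → Vec d | HasNeighbor (8 * sigma t / alpha t * Real.sqrt d) D i}.indicator 1 D :=
    fun i => Set.indicator_nonneg (fun _ _ => zero_le_one) _
  -- Near means within `4σ√d` of `x` after scaling by `α`, so two near points are
  -- `8σ√d/α`-neighbours.
  set near : Fin n → Prop := fun i => ¬ 16 * (d : ℝ) < ‖x - alpha t • D i‖ ^ 2 / sigma t ^ 2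
    with hnear
  by_cases h : ∃ i, near i ∧ ∀ j, near j → j = i
  · obtain ⟨i₀, hi₀, huniq⟩ := h
    refine ⟨condScore t (D i₀) x, fun i => ?_⟩
    by_cases hi : i = i₀
    · subst hi
      have := hind i
      rw [sub_self, norm_zero, zero_pow two_ne_zero]
      positivity
    · have hfar : 16 * (d : ℝ) < ‖x - alpha t • D i‖ ^ 2 / sigma t ^ 2 :=
        not_not.1 fun hni => hi (huniq i hni)
      rw [if_pos hfar, mul_one]
      -- A far point has the larger conditional score, so its error is at most `(2‖condScore‖)²`;
      -- this is the factor `4`.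
      have hle : ‖condScore t (D i₀) x‖ ^ 2 ≤ ‖condScore t (D i) x‖ ^ 2 := by
        rw [norm_condScore_sq, norm_condScore_sq]
        gcongr ?_ / _
        exact (not_lt.1 hi₀).trans hfar.le
      have hle' := abs_le_of_sq_le_sq hle (norm_nonneg _)
      have htri := norm_sub_le (condScore t (D i) x) (condScore t (D i₀) x)
      have hnn := norm_nonneg (condScore t (D i) x)
      calc ‖condScore t (D i) x - condScore t (D i₀) x‖ ^ 2
          ≤ (2 * ‖condScore t (D i) x‖) ^ 2 := by
            gcongr
            linarith [(le_abs_self _).trans hle']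
        _ = ‖condScore t (D i) x‖ ^ 2 * 4 := by ring
        _ ≤ _ := by
          gcongr
          linarith [hind i]
  -- With no near point or several, guess `0`: each point is then far or has a neighbour, so the
  -- bracket is at least `1`.
  · refine ⟨0, fun i => ?_⟩
    rw [sub_zero]
    refine le_mul_of_one_le_right (by positivity) ?_
    by_cases hi : near i
    · obtain ⟨j, hj, hji⟩ : ∃ j, near j ∧ j ≠ i := by
        by_contra! hcon
        exact h ⟨i, hi, hcon⟩
      have hdist : ∀ k, near k → ‖x - alpha t • D k‖ ≤ 4 * sigma t * Real.sqrt d := by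
        intro k hk
        rw [hnear, not_lt, div_le_iff₀ (by positivity)] at hk
        refine le_of_sq_le_sq ?_ (by positivity)
        rw [mul_pow, Real.sq_sqrt (Nat.cast_nonneg d)]
        linarith
      have hmem : HasNeighbor (8 * sigma t / alpha t * Real.sqrt d) D i := by
        refine ⟨j, hji, ?_⟩
        have e : alpha t • (D i - D j) = (x - alpha t • D j) - (x - alpha t • D i) := by
          rw [smul_sub]; abel
        have h1 := norm_sub_le (x - alpha t • D j) (x - alpha t • D i)
        rw [← e, norm_smul, Real.norm_eq_abs, abs_of_pos ha] at h1
        rw [div_mul_eq_mul_div, le_div_iff₀ ha]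
        linarith [hdist i hi, hdist j hj]
      rw [Set.indicator_of_mem (show D ∈ {D | HasNeighbor _ D i} from hmem), Pi.one_apply]
      split_ifs <;> norm_num
    · rw [if_pos (not_not.1 hi)]
      linarith [hind i]

/-- Only the sum over the data is controlled, because the empirical score is optimal for the
empirical law and not at each point separately. -/
theorem sum_edenoisingLoss_empirical_le (ht : 0 < t) (hn : 1 ≤ n) (D : Fin n → Vec d) :
    ∑ i, edenoisingLoss t (D i) (score t (empiricalLaw D)) ≤
      ∑ i, ENNReal.ofReal (8 / sigma t ^ 2 * 2 ^ ((d : ℝ) / 2) * (4 * Real.exp (-2 * d) +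
        {D | HasNeighbor (8 * sigma t / alpha t * Real.sqrt d) D i}.indicator 1 D)) := by
  have hs := sigma_pos ht
  have := isProbabilityMeasure_empiricalLaw hn D
  have hn0 : (n : ENNReal)⁻¹ ≠ 0 := ENNReal.inv_ne_zero.2 (ENNReal.natCast_ne_top n)
  have hn1 : (n : ENNReal)⁻¹ ≠ ⊤ := ENNReal.inv_ne_top.2 (by simp; omega)
  rw [← ENNReal.mul_le_mul_iff_right hn0 hn1,
    ← lintegral_empiricalLaw D fun y => edenoisingLoss t y (score t (empiricalLaw D)),
    lintegral_edenoisingLoss _ (measurable_score _ ht)]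
  set N : Fin n → ℝ := fun i =>
    {D | HasNeighbor (8 * sigma t / alpha t * Real.sqrt d) D i}.indicator 1 D with hN
  have hind : ∀ i, (0 : ℝ) ≤ N i := fun i => Set.indicator_nonneg (fun _ _ => zero_le_one) _
  calc _ ≤ ∫⁻ x, (n : ENNReal)⁻¹ * ∑ i, ENNReal.ofReal (8 / sigma t ^ 2 *
          (4 * Real.exp (-2 * d) + N i)) * ENNReal.ofReal
          (Real.exp (‖x - alpha t • D i‖ ^ 2 / sigma t ^ 2 / 4) *
          transitionDensity t (D i) x) := by
        refine lintegral_mono fun x => ?_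
        obtain ⟨v, hv⟩ := exists_estimator ht D x
        refine (lintegral_condScore_sub_score_le _ ht x v).trans ?_
        rw [lintegral_empiricalLaw D]
        gcongr with i
        have hi := hind i
        rw [← ENNReal.ofReal_mul (by positivity), ← mul_assoc]
        have hφ := (transitionDensity_pos ht (D i) x).le
        gcongr
        refine (hv i).trans ?_
        have hcs := norm_condScore_sq_le_exp ht (D i) x
        set w := ‖x - alpha t • D i‖ ^ 2 / sigma t ^ 2 with hw
        have hw0 : 0 ≤ w := by positivity
        -- If `w > 16d`, then `w/8 ≤ w/4 - 2d`: the threshold `16` is what yields `e^{-2d}`.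
        have h1 : Real.exp (w / 8) * (if 16 * (d : ℝ) < w then 1 else 0) ≤
            Real.exp (-2 * d) * Real.exp (w / 4) := by
          split_ifs with hlt
          · rw [mul_one, ← Real.exp_add]
            gcongr
            linarith
          · rw [mul_zero]; positivity
        have h2 : Real.exp (w / 8) ≤ Real.exp (w / 4) := by gcongr; norm_num
        calc _ ≤ (8 / sigma t ^ 2 * Real.exp (w / 8)) *
              (4 * (if 16 * (d : ℝ) < w then 1 else 0) + N i) := by
              gcongr
          _ = 8 / sigma t ^ 2 * (4 * (Real.exp (w / 8) * (if 16 * (d : ℝ) < w then 1 else 0)) +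
              N i * Real.exp (w / 8)) := by ring
          _ ≤ 8 / sigma t ^ 2 * (4 * (Real.exp (-2 * d) * Real.exp (w / 4)) +
              N i * Real.exp (w / 4)) := by gcongr
          _ = _ := by ring
    _ = (n : ENNReal)⁻¹ * ∑ i, ENNReal.ofReal (8 / sigma t ^ 2 *
          (4 * Real.exp (-2 * d) + N i)) * ENNReal.ofReal (2 ^ ((d : ℝ) / 2)) := by
        rw [lintegral_const_mul' _ _ hn1, lintegral_finsetSum]
        · congr 1
          refine Finset.sum_congr rfl fun i _ => ?_
          rw [lintegral_const_mul' _ _ ENNReal.ofReal_ne_top,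
            lintegral_exp_mul_transitionDensity ht]
        · intro i _
          have := (continuous_transitionDensity_right (t := t) (D i)).measurable
          fun_prop
    _ = _ := by
        congr 1
        refine Finset.sum_congr rfl fun i _ => ?_
        have hi := hind i
        rw [← ENNReal.ofReal_mul (by positivity)]
        congr 1
        ring

theorem sum_denoisingLoss_empirical_le (ht : 0 < t) (hn : 1 ≤ n) (D : Fin n → Vec d) :
    ∑ i, denoisingLoss t (D i) (score t (empiricalLaw D)) ≤
      ∑ i, 8 / sigma t ^ 2 * 2 ^ ((d : ℝ) / 2) * (4 * Real.exp (-2 * d) +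
        {D | HasNeighbor (8 * sigma t / alpha t * Real.sqrt d) D i}.indicator 1 D) := by
  have hs := sigma_pos ht
  have := isProbabilityMeasure_empiricalLaw hn D
  have h := sum_edenoisingLoss_empirical_le ht hn D
  have hnn : ∀ i, (0 : ℝ) ≤ 8 / sigma t ^ 2 * 2 ^ ((d : ℝ) / 2) * (4 * Real.exp (-2 * d) +
      {D | HasNeighbor (8 * sigma t / alpha t * Real.sqrt d) D i}.indicator 1 D) := fun i => by
    have : (0 : ℝ) ≤
        {D | HasNeighbor (8 * sigma t / alpha t * Real.sqrt d) D i}.indicator 1 D :=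
      Set.indicator_nonneg (fun _ _ => zero_le_one) _
    positivity
  rw [← ENNReal.ofReal_sum_of_nonneg fun i _ => hnn i] at h
  have hfin : ∀ i, edenoisingLoss t (D i) (score t (empiricalLaw D)) ≠ ⊤ := fun i =>
    (ENNReal.sum_lt_top.1 (h.trans_lt ENNReal.ofReal_lt_top) i (Finset.mem_univ i)).ne
  simp_rw [denoisingLoss_eq_toReal ht _ (measurable_score (empiricalLaw D) ht)]
  rw [← ENNReal.toReal_sum fun i _ => hfin i]
  exact ENNReal.toReal_le_of_le_ofReal (Finset.sum_nonneg fun i _ => hnn i) h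

/-- By Tweedie's formula the empirical score is a ratio of finite sums, jointly measurable in the
data and `x`. -/
theorem measurable_denoisingLoss_empirical (ht : 0 < t) (hn : 1 ≤ n) (i : Fin n) :
    Measurable fun D : Fin n → Vec d => denoisingLoss t (D i) (score t (empiricalLaw D)) := by
  have hφ : ∀ j, Measurable fun p : (Fin n → Vec d) × Vec d =>
      transitionDensity t (p.1 j) p.2 := fun j => by
    unfold transitionDensity; fun_prop
  have hu : ∀ j, Measurable fun p : (Fin n → Vec d) × Vec d => condScore t (p.1 j) p.2 := fun j => by
    unfold condScore; fun_prop
  have hscore : Measurable fun p : (Fin n → Vec d) × Vec d => score t (empiricalLaw p.1) p.2 := by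
    have e : (fun p : (Fin n → Vec d) × Vec d => score t (empiricalLaw p.1) p.2) = fun p =>
        ((n : ℝ)⁻¹ • ∑ j, transitionDensity t (p.1 j) p.2)⁻¹ •
          ((n : ℝ)⁻¹ • ∑ j, transitionDensity t (p.1 j) p.2 • condScore t (p.1 j) p.2) := by
      ext1 p
      have := isProbabilityMeasure_empiricalLaw hn p.1
      rw [score_eq _ ht, marginalDensity, integral_empiricalLaw, integral_empiricalLaw]
    rw [e]
    exact ((Finset.measurable_fun_sum _ fun j _ => hφ j).const_smul (n : ℝ)⁻¹).inv.smul
      ((Finset.measurable_fun_sum _ fun j _ => (hφ j).smul (hu j)).const_smul (n : ℝ)⁻¹)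
  have e : (fun D : Fin n → Vec d => denoisingLoss t (D i) (score t (empiricalLaw D))) =
      fun D => (edenoisingLoss t (D i) (score t (empiricalLaw D))).toReal := by
    ext1 D
    have := isProbabilityMeasure_empiricalLaw hn D
    exact denoisingLoss_eq_toReal ht _ (measurable_score _ ht)
  rw [e]
  refine Measurable.ennreal_toReal (Measurable.lintegral_prod_right'
    (f := fun p : (Fin n → Vec d) × Vec d => ENNReal.ofReal
      (‖condScore t (p.1 i) p.2 - score t (empiricalLaw p.1) p.2‖ ^ 2 *
        transitionDensity t (p.1 i) p.2)) ?_)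
  exact ENNReal.measurable_ofReal.comp ((((hu i).sub hscore).norm.pow_const 2).mul (hφ i))

theorem measurableSet_hasNeighbor (ρ : ℝ) (i : Fin n) :
    MeasurableSet {D : Fin n → Vec d | HasNeighbor ρ D i} := by
  have : {D : Fin n → Vec d | HasNeighbor ρ D i} =
      ⋃ j : Fin n, ⋃ _ : j ≠ i, {D | ‖D i - D j‖ ≤ ρ} := by
    ext D; simp [HasNeighbor]
  rw [this]
  exact .iUnion fun j => .iUnion fun _ => measurableSet_le (by fun_prop) measurable_const

variable (P : Measure (Vec d)) [IsProbabilityMeasure P]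

/-- By independence, fix `D j`; then `D i` must fall in a ball around it. -/
theorem pi_norm_sub_le {ρ : ℝ} {η : ENNReal} (hη : ∀ x, P (Metric.closedBall x ρ) ≤ η)
    {i j : Fin n} (hij : j ≠ i) :
    Measure.pi (fun _ : Fin n => P) {D | ‖D i - D j‖ ≤ ρ} ≤ η := by
  have hind := (iIndepFun_pi (μ := fun _ : Fin n => P) (X := fun _ => id)
    fun _ => aemeasurable_id).indepFun hij
  have hmap := (indepFun_iff_map_prod_eq_prod_map_map (measurable_pi_apply j).aemeasurable
    (measurable_pi_apply i).aemeasurable).1 hind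
  have hev : ∀ k, (Measure.pi fun _ : Fin n => P).map (fun D => D k) = P := fun k =>
    (measurePreserving_eval (fun _ : Fin n => P) k).map_eq
  rw [hev, hev] at hmap
  have hms : MeasurableSet {p : Vec d × Vec d | ‖p.2 - p.1‖ ≤ ρ} :=
    measurableSet_le (by fun_prop) measurable_const
  have e : {D : Fin n → Vec d | ‖D i - D j‖ ≤ ρ} =
      (fun D => (D j, D i)) ⁻¹' {p : Vec d × Vec d | ‖p.2 - p.1‖ ≤ ρ} := rfl
  rw [e, ← Measure.map_apply (by fun_prop) hms, hmap, Measure.prod_apply hms]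
  calc _ ≤ ∫⁻ _, η ∂P := by
        refine lintegral_mono fun x => ?_
        refine le_trans (le_of_eq ?_) (hη x)
        congr 1
    _ = η := by simp

theorem pi_hasNeighbor_le {ρ : ℝ} {η : ENNReal} (hη : ∀ x, P (Metric.closedBall x ρ) ≤ η)
    (i : Fin n) : Measure.pi (fun _ : Fin n => P) {D | HasNeighbor ρ D i} ≤ n * η := by
  calc _ ≤ Measure.pi (fun _ : Fin n => P)
        (⋃ j ∈ Finset.univ.filter (· ≠ i), {D | ‖D i - D j‖ ≤ ρ}) := by
        refine measure_mono fun D hD => ?_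
        obtain ⟨j, hj, h⟩ := hD
        exact Set.mem_biUnion (by simpa using hj) h
    _ ≤ ∑ j ∈ Finset.univ.filter (· ≠ i), η :=
        (measure_biUnion_finset_le _ _).trans
          (Finset.sum_le_sum fun j hj => pi_norm_sub_le P hη (by simpa using hj))
    _ ≤ ∑ _ : Fin n, η := Finset.sum_le_sum_of_subset (Finset.filter_subset _ _)
    _ = n * η := by simp

/-- Each `D i` has law `P` and `score t P` does not depend on the data, so the population term
averages to at least `c`; a union bound over neighbours controls the empirical term. -/
theorem le_integral_lossGap (ht : 0 < t) (hn : 1 ≤ n) {c η : ℝ} (hη0 : 0 ≤ η)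
    (h : ∀ x v, ENNReal.ofReal c * ∫⁻ x₀, ENNReal.ofReal (transitionDensity t x₀ x) ∂P ≤
      ∫⁻ x₀, ENNReal.ofReal (‖condScore t x₀ x - v‖ ^ 2 * transitionDensity t x₀ x) ∂P)
    (hη : ∀ x, P (Metric.closedBall x (8 * sigma t / alpha t * Real.sqrt d)) ≤
      ENNReal.ofReal η) :
    c - 8 / sigma t ^ 2 * 2 ^ ((d : ℝ) / 2) * (4 * Real.exp (-2 * d) + n * η) ≤
      ∫ D : Fin n → Vec d, lossGap t P D ∂(Measure.pi fun _ : Fin n => P) := by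
  have hs := sigma_pos ht
  have hn0 : (0 : ℝ) < n := by exact_mod_cast hn
  set π := Measure.pi fun _ : Fin n => P with hπ
  set κ := 8 / sigma t ^ 2 * 2 ^ ((d : ℝ) / 2) with hκ
  have hκ0 : 0 < κ := by positivity
  set N : Fin n → Set (Fin n → Vec d) := fun i =>
    {D | HasNeighbor (8 * sigma t / alpha t * Real.sqrt d) D i} with hN
  have hNm : ∀ i, MeasurableSet (N i) := measurableSet_hasNeighbor _
  have hNi : ∀ i, Integrable ((N i).indicator (1 : (Fin n → Vec d) → ℝ)) π := fun i =>
    (integrable_indicator_iff (hNm i)).2 (integrable_const (1 : ℝ)).integrableOn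
  have hmp : ∀ i, MeasurePreserving (Function.eval i) π P := fun i =>
    measurePreserving_eval (fun _ : Fin n => P) i
  have hpop : ∀ i, Integrable (fun D : Fin n → Vec d => denoisingLoss t (D i) (score t P)) π :=
    fun i => (hmp i).integrable_comp_of_integrable (integrable_denoisingLoss_score P ht)
  have hpopv : ∀ i, ∫ D : Fin n → Vec d, denoisingLoss t (D i) (score t P) ∂π =
      ∫ x₀, denoisingLoss t x₀ (score t P) ∂P := fun i => by
    have h := integral_map (μ := π) (φ := Function.eval i)
      (f := fun x₀ => denoisingLoss t x₀ (score t P)) (hmp i).measurable.aemeasurable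
      (by rw [(hmp i).map_eq]; exact (integrable_denoisingLoss_score P ht).aestronglyMeasurable)
    rw [(hmp i).map_eq] at h
    exact h.symm
  have hterm : ∀ i, Integrable (fun D => κ * (4 * Real.exp (-2 * d) + (N i).indicator 1 D)) π :=
    fun i => ((integrable_const _).add (hNi i)).const_mul κ
  have hbound : Integrable (fun D => ∑ i, κ * (4 * Real.exp (-2 * d) +
      (N i).indicator 1 D)) π :=
    integrable_finsetSum _ fun i _ => hterm i
  have hemp : Integrable (fun D : Fin n → Vec d =>
      ∑ i, denoisingLoss t (D i) (score t (empiricalLaw D))) π := by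
    refine hbound.mono' (Finset.measurable_fun_sum _ fun i _ =>
      measurable_denoisingLoss_empirical ht hn i).aestronglyMeasurable (.of_forall fun D => ?_)
    rw [Real.norm_eq_abs, abs_of_nonneg]
    · exact sum_denoisingLoss_empirical_le ht hn D
    · exact Finset.sum_nonneg fun i _ => integral_nonneg fun x => by positivity
  have hempv : ∫ D : Fin n → Vec d, ∑ i, denoisingLoss t (D i) (score t (empiricalLaw D)) ∂π ≤
      n * (κ * (4 * Real.exp (-2 * d) + n * η)) := by
    calc _ ≤ ∫ D, ∑ i, κ * (4 * Real.exp (-2 * d) + (N i).indicator 1 D) ∂π :=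
          integral_mono hemp hbound fun D => sum_denoisingLoss_empirical_le ht hn D
      _ = ∑ i, κ * (4 * Real.exp (-2 * d) + π.real (N i)) := by
          rw [integral_finsetSum _ fun i _ => hterm i]
          refine Finset.sum_congr rfl fun i _ => ?_
          rw [integral_const_mul, integral_add (integrable_const _) (hNi i),
            integral_indicator_one (hNm i)]
          simp
      _ ≤ ∑ _ : Fin n, κ * (4 * Real.exp (-2 * d) + n * η) := by
          gcongr with i
          refine ENNReal.toReal_le_of_le_ofReal (by positivity) ?_
          rw [ENNReal.ofReal_mul hn0.le, ENNReal.ofReal_natCast]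
          exact pi_hasNeighbor_le P hη i
      _ = _ := by simp
  have hc := le_integral_denoisingLoss_score P ht h
  have e : (fun D : Fin n → Vec d => lossGap t P D) = fun D =>
      (1 / (n : ℝ)) * ((∑ i, denoisingLoss t (D i) (score t P)) -
        ∑ i, denoisingLoss t (D i) (score t (empiricalLaw D))) := by
    ext1 D
    rw [lossGap, Finset.sum_sub_distrib]
  rw [e, integral_const_mul, integral_sub (integrable_finsetSum _ fun i _ => hpop i) hemp,
    integral_finsetSum _ fun i _ => hpop i]
  simp only [hpopv, Finset.sum_const, Finset.card_univ, Fintype.card_fin, nsmul_eq_mul]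
  have hle : (n : ℝ) * (c - κ * (4 * Real.exp (-2 * d) + n * η)) ≤
      n * ∫ x₀, denoisingLoss t x₀ (score t P) ∂P -
      ∫ D : Fin n → Vec d, ∑ i, denoisingLoss t (D i) (score t (empiricalLaw D)) ∂π := by
    have := mul_le_mul_of_nonneg_left hc hn0.le
    linarith
  rw [one_div, ← div_eq_inv_mul, le_div_iff₀ hn0]
  linarith

end Empirical

end Loss

/-! ### Passage to mixtures, and the choice of constants. -/

section Mixture

variable {d K : ℕ} {μ : Fin K → Vec d} {S : Matrix (Fin d) (Fin d) ℝ} {ν : Fin K → Measure (Vec d)}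

/-- Both sides are linear in the law and `c` is common to the components, so the posterior of the
mixture needs no analysis of its own. -/
theorem le_lintegral_mixtureLaw {f g : Vec d → ENNReal} {c : ENNReal}
    (h : ∀ k, c * ∫⁻ x, f x ∂(componentLaw (μ k) S (ν k)) ≤
      ∫⁻ x, g x ∂(componentLaw (μ k) S (ν k))) :
    c * ∫⁻ x, f x ∂(mixtureLaw μ S ν) ≤ ∫⁻ x, g x ∂(mixtureLaw μ S ν) := by
  rw [lintegral_mixtureLaw, lintegral_mixtureLaw, mul_left_comm, Finset.mul_sum]
  gcongr with k
  exact h k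

theorem mixtureLaw_apply_le (hK : 1 ≤ K) {s : Set (Vec d)} {η : ENNReal}
    (h : ∀ k, componentLaw (μ k) S (ν k) s ≤ η) : mixtureLaw μ S ν s ≤ η := by
  rw [mixtureLaw, Measure.smul_apply, Measure.finsetSum_apply, smul_eq_mul]
  calc _ ≤ (K : ENNReal)⁻¹ * ∑ _ : Fin K, η := by gcongr with k; exact h k
    _ = η := by
      simp only [Finset.sum_const, Finset.card_univ, Fintype.card_fin, nsmul_eq_mul]
      rw [← mul_assoc, ENNReal.inv_mul_cancel (by simp; omega) (ENNReal.natCast_ne_top K),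
        one_mul]

end Mixture

/-- Cauchy–Schwarz on the diagonal. -/
theorem trace_le_sqrt_mul_frobenius {d : ℕ} (S : Matrix (Fin d) (Fin d) ℝ) :
    S.trace ≤ Real.sqrt d * frobenius S := by
  rw [frobenius, ← Real.sqrt_mul (Nat.cast_nonneg d)]
  refine Real.le_sqrt_of_sq_le ?_
  calc S.trace ^ 2 ≤ d * ∑ i, S i i ^ 2 := by
        simpa [Matrix.trace] using sq_sum_le_card_mul_sum_sq (s := Finset.univ) (f := fun i => S i i)
    _ ≤ d * ∑ i, ∑ j, S i j ^ 2 := by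
        gcongr with i
        exact Finset.single_le_sum (f := fun j => S i j ^ 2) (fun j _ => sq_nonneg _)
          (Finset.mem_univ i)

theorem tendsto_rpow_half_atTop {r : ℝ} (h0 : 0 < r) (h1 : r < 1) :
    Filter.Tendsto (fun d : ℕ => r ^ ((d : ℝ) / 2)) Filter.atTop (nhds 0) :=
  (tendsto_rpow_atTop_of_base_lt_one r (by linarith) h1).comp
    (tendsto_natCast_atTop_atTop.atTop_div_const (by norm_num))

/-- The lower bound for the estimation error is at least `d / (128 σ²)` once `σ` is small. -/
theorem estimation_constant_ge {C α s d : ℝ} (hC : 0 < C) (hα : 0 < α) (hs : 0 < s) (hd : 0 ≤ d)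
    (h : C * s ^ 2 ≤ α ^ 2) :
    d / (128 * s ^ 2) ≤ (α / s ^ 2) ^ 2 * (1 / 32 / (C + α ^ 2 / s ^ 2) * d) * (1 / 2) := by
  have h1 : C ≤ α ^ 2 / s ^ 2 := by rwa [le_div_iff₀ (by positivity)]
  calc d / (128 * s ^ 2) = (α / s ^ 2) ^ 2 * (1 / 32 / (α ^ 2 / s ^ 2 + α ^ 2 / s ^ 2) * d) *
        (1 / 2) := by
        field_simp
        ring
    _ ≤ _ := by gcongr

/-- The exponent `-4 - 2b`, halved, gives `-2d - bd`: the part `bd` pays for `n`, the rest remains.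
-/
theorem natCast_mul_rpow_half_le {b r : ℝ} {d n : ℕ} (hn : 1 ≤ n) (hlog : Real.log n ≤ b * d)
    (hr : 0 ≤ r) (h : r ≤ Real.exp (-4 - 2 * b)) :
    n * r ^ ((d : ℝ) / 2) ≤ Real.exp (-2 * d) := by
  have hn0 : (0 : ℝ) < n := by exact_mod_cast hn
  calc n * r ^ ((d : ℝ) / 2) ≤ Real.exp (b * d) * Real.exp (-4 - 2 * b) ^ ((d : ℝ) / 2) := by
        gcongr
        exact (Real.log_le_iff_le_exp hn0).1 hlog
    _ = Real.exp (-2 * d) := by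
        rw [← Real.exp_mul, ← Real.exp_add]
        ring_nf

/-- The empirical score's loss is negligible in high dimension. -/
theorem memorization_error_le {A s d x : ℝ} (hd : 0 ≤ d) (h : 2048 * (4 + A ^ 2) ≤ d)
    {n : ℝ} (hx : n * x ≤ Real.exp (-2 * d)) :
    8 / s ^ 2 * 2 ^ (d / 2) * (4 * Real.exp (-2 * d) + n * (A ^ 2 * x)) ≤ d / (256 * s ^ 2) := by
  have herr : 4 * Real.exp (-2 * d) + n * (A ^ 2 * x) ≤ (4 + A ^ 2) * Real.exp (-2 * d) := by
    have := mul_le_mul_of_nonneg_left hx (sq_nonneg A)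
    linarith
  have hpow : (2 : ℝ) ^ (d / 2) * Real.exp (-2 * d) ≤ 1 := by
    have h2e : (2 : ℝ) ≤ Real.exp 1 := by linarith [Real.exp_one_gt_d9]
    calc (2 : ℝ) ^ (d / 2) * Real.exp (-2 * d)
        ≤ Real.exp 1 ^ (d / 2) * Real.exp (-2 * d) := by gcongr
      _ = Real.exp (d / 2 + -2 * d) := by rw [← Real.exp_mul, ← Real.exp_add, one_mul]
      _ ≤ 1 := Real.exp_le_one_iff.2 (by linarith)
  calc _ ≤ 8 / s ^ 2 * 2 ^ (d / 2) * ((4 + A ^ 2) * Real.exp (-2 * d)) := by gcongr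
    _ = 8 * (4 + A ^ 2) / s ^ 2 * (2 ^ (d / 2) * Real.exp (-2 * d)) := by ring
    _ ≤ 8 * (4 + A ^ 2) / s ^ 2 * 1 := by gcongr
    _ = 2048 * (4 + A ^ 2) / (256 * s ^ 2) := by
      rw [mul_one, show 2048 * (4 + A ^ 2) = 256 * (8 * (4 + A ^ 2)) by ring,
        mul_div_mul_left _ _ (by norm_num)]
    _ ≤ _ := by gcongr

theorem trace_le_of_frobenius_le {d : ℕ} {S : Matrix (Fin d) (Fin d) ℝ} {c : ℝ}
    (h : frobenius S ≤ c * Real.sqrt d) : S.trace ≤ c * d :=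
  calc S.trace ≤ Real.sqrt d * (c * Real.sqrt d) :=
        (trace_le_sqrt_mul_frobenius S).trans (by gcongr)
    _ = c * d := by rw [mul_left_comm, Real.mul_self_sqrt (Nat.cast_nonneg d)]

/-- Half of the estimation bound absorbs the error `e`; the other half dominates the trace, since `d
≤ d/s²` for `s ≤ 1`. -/
theorem le_gap_of_bounds {a c d e s T : ℝ} (hc : 0 < c) (hd : 0 ≤ d) (hs : 0 < s) (hs1 : s ≤ 1)
    (hT : T ≤ c * d) (ha : d / (128 * s ^ 2) ≤ a) (he : e ≤ d / (256 * s ^ 2)) :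
    1 / (256 * (1 + c)) * (d / s ^ 2 + T) ≤ a - e := by
  have hds : d ≤ d / s ^ 2 := le_div_self hd (by positivity) (pow_le_one₀ hs.le hs1)
  have hlhs : 1 / (256 * (1 + c)) * (d / s ^ 2 + T) ≤ d / (256 * s ^ 2) := by
    calc _ ≤ 1 / (256 * (1 + c)) * (d / s ^ 2 + c * (d / s ^ 2)) := by
          gcongr
          exact hT.trans (by gcongr)
      _ = _ := by field_simp
  have hhalf : d / (128 * s ^ 2) = d / (256 * s ^ 2) + d / (256 * s ^ 2) := by
    field_simp
    ring
  linarith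

end DiffusionGap

/-! ### Assembly. -/

open DiffusionGap in
theorem theorem4p1 (C cf β B C₁ C₂ C₃ R δ₁ δ₂ a₀ a₁ b : ℝ)
    (hC : 0 < C) (hcf : 0 < cf) (hβ : 0 < β) (hB : 0 < B)
    (hC₁ : 0 < C₁) (hC₂ : 0 < C₂) (hC₃ : 0 < C₃) (hR : 0 < R)
    (hδ₁ : 0 < δ₁) (hδ₂ : 0 < δ₂) (ha₀ : 0 < a₀) (ha₁ : 0 < a₁) (hb : 0 < b) :
    ∃ c : ℝ, 0 < c ∧ ∃ d₀ : ℕ, ∀ d : ℕ, d₀ ≤ d →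
      ∀ (K n : ℕ), 1 ≤ K → 1 ≤ n →
      ∀ (μ : Fin K → Vec d) (S : Matrix (Fin d) (Fin d) ℝ)
        (ν : Fin K → MeasureTheory.Measure (Vec d)),
        (∀ k, ComponentAssumption C cf β B C₁ C₂ C₃ R (μ k) S (ν k)) →
        (2 ≤ K → δ₁ * Real.sqrt d ≤ minSeparation μ ∧ minSeparation μ ≤ δ₂ * Real.sqrt d) →
        Real.log n ≤ b * d →
        ∀ t₀ t₁ : ℝ, 0 < t₀ →
          -a₀ * d ≤ Real.log (sigma t₀) →
          Real.log (sigma t₁) ≤ -a₁ * Real.log d →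
          ∀ t ∈ Set.Icc t₀ t₁,
            c * (d / sigma t ^ 2 + S.trace) ≤
              ∫ D : Fin n → Vec d, lossGap t (mixtureLaw μ S ν) D
                ∂(MeasureTheory.Measure.pi fun _ : Fin n => mixtureLaw μ S ν) := by
  obtain ⟨A, hA, hdoubling⟩ := exists_gaussianDoubling hcf hβ hB (half_pos hC)
  refine ⟨1 / (256 * (1 + C₂)), by positivity, ?_⟩
  -- The three caps on `σ²` ensure `α² ≥ 1/2`, then `Cσ² ≤ 1/2 ≤ α²`, and `r = 128eCσ²/α² ≤
  -- e^{-4-2b}`.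
  set s₀ : ℝ := min (1 / 2) (min (1 / (2 * C)) (Real.exp (-4 - 2 * b) / (256 * Real.exp 1 * C)))
    with hs₀d
  have hs₀ : 0 < s₀ := by positivity
  -- With `ε² = 1/32` the base is `e/16 < 1`, so posterior balls eventually have mass below `1/2`.
  have ev1 : ∀ᶠ d : ℕ in Filter.atTop,
      (2 * Real.exp 1 * (Real.sqrt (1 / 32)) ^ 2) ^ ((d : ℝ) / 2) < 1 / (2 * A ^ 2) := by
    refine (tendsto_rpow_half_atTop (by positivity) ?_).eventually_lt_const (by positivity)
    rw [Real.sq_sqrt (by norm_num)]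
    linarith [Real.exp_one_lt_d9]
  have ev2 : ∀ᶠ d : ℕ in Filter.atTop, (d : ℝ) ^ (-a₁) < Real.sqrt s₀ :=
    ((tendsto_rpow_neg_atTop ha₁).comp tendsto_natCast_atTop_atTop).eventually_lt_const
      (Real.sqrt_pos.2 hs₀)
  -- `2048 = 8 · 256` lets `8(4 + A²)/σ²` fit into `d/(256σ²)`.
  have ev3 : ∀ᶠ d : ℕ in Filter.atTop, 2048 * (4 + A ^ 2) ≤ (d : ℝ) :=
    tendsto_natCast_atTop_atTop.eventually_ge_atTop _
  obtain ⟨d₀, hd₀⟩ := Filter.eventually_atTop.1 (ev1.and (ev2.and (ev3.and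
    (Filter.eventually_ge_atTop 1))))
  refine ⟨d₀, fun d hd K n hK hn μ S ν hcomp _ hlogn t₀ t₁ ht₀ _ ht₁ t ht => ?_⟩
  obtain ⟨h1, h2, h3, hd1⟩ := hd₀ d hd
  have ht0 : 0 < t := ht₀.trans_le ht.1
  have hs := sigma_pos ht0
  have hα := alpha_pos t
  have hd0 : (0 : ℝ) < d := by exact_mod_cast hd1
  have hσ : sigma t ^ 2 ≤ s₀ := by
    have hle : sigma t ≤ Real.sqrt s₀ := by
      refine (sigma_mono ht.2).trans (le_trans ?_ h2.le)
      rw [Real.rpow_def_of_pos hd0, ← Real.log_le_iff_le_exp (sigma_pos (ht0.trans_le ht.2))]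
      linarith
    calc sigma t ^ 2 ≤ Real.sqrt s₀ ^ 2 := by gcongr
      _ = s₀ := Real.sq_sqrt hs₀.le
  have hσ1 : sigma t ^ 2 ≤ 1 / 2 := hσ.trans (min_le_left _ _)
  have hσ2 : sigma t ^ 2 ≤ 1 / (2 * C) := hσ.trans ((min_le_right _ _).trans (min_le_left _ _))
  have hσ3 : sigma t ^ 2 ≤ Real.exp (-4 - 2 * b) / (256 * Real.exp 1 * C) :=
    hσ.trans ((min_le_right _ _).trans (min_le_right _ _))
  have hα2 : 1 / 2 ≤ alpha t ^ 2 := by rw [alpha_sq ht0]; linarith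
  have hprob : ∀ k, IsProbabilityMeasure (componentLaw (μ k) S (ν k)) := fun k =>
    (hcomp k).isProbabilityMeasure_componentLaw
  have htilt : ∀ k, IsGaussianTilt C A (componentLaw (μ k) S (ν k)) := fun k =>
    (hcomp k).isGaussianTilt hcf (hdoubling d)
  have := isProbabilityMeasure_mixtureLaw hK hprob
  set r := 2 * Real.exp 1 * C * (8 * sigma t / alpha t) ^ 2 with hrd
  have hr : r ≤ Real.exp (-4 - 2 * b) := by
    rw [le_div_iff₀ (by positivity)] at hσ3
    have : r = 128 * Real.exp 1 * C * sigma t ^ 2 / alpha t ^ 2 := by rw [hrd]; ring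
    rw [this, div_le_iff₀ (by positivity)]
    nlinarith [Real.exp_pos (-4 - 2 * b)]
  have main := le_integral_lossGap (mixtureLaw μ S ν) ht0 hn
    (c := (alpha t / sigma t ^ 2) ^ 2 *
      (Real.sqrt (1 / 32) ^ 2 / (C + alpha t ^ 2 / sigma t ^ 2) * d) * (1 / 2))
    (η := A ^ 2 * r ^ ((d : ℝ) / 2)) (by positivity)
    (fun x v => le_lintegral_mixtureLaw fun k =>
      (htilt k).le_lintegral_condScore_sub hC hA (by positivity) ht0
        (by rw [lt_div_iff₀ (by positivity)] at h1; linarith) x v)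
    (fun x => mixtureLaw_apply_le hK fun k =>
      (htilt k).measure_closedBall_le hC hA (by positivity) x)
  refine le_trans ?_ main
  rw [Real.sq_sqrt (by norm_num)]
  have hest := estimation_constant_ge hC hα hs hd0.le (by
    rw [le_div_iff₀ (by positivity)] at hσ2; linarith)
  have hloss := memorization_error_le (s := sigma t) (by positivity) h3
    (natCast_mul_rpow_half_le hn hlogn (by positivity) hr)
  exact le_gap_of_bounds hC₂ hd0.le hs (sigma_le_one t)
    (trace_le_of_frobenius_le (hcomp ⟨0, hK⟩).frobenius_le) hest hloss
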